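/- Let $F=\mathbb F_q$ be a finite field with $q$ elements and let $n\ge 1$. An element $g$ of a group $G$ is real if $hgh^{-1}=g^{-1}$ for some $h\in G$, and strongly real if $h$ can moreover be chosen with $h^2=1$; a conjugacy class is real (strongly real) if its elements are. For $d\ge 1$ let $n_{q,d}$ be the number of polynomials $f\in\mathbb F_q[t]$ of degree $d$ with $f(0)=1$ that are self-reciprocal, i.e. whose multiset of roots $[\alpha_1,\dots,\alpha_d]$ in $\overline{\mathbb F_q}$ (with multiplicity) equals $[\alpha_1^{-1},\dots,\alpha_d^{-1}]$. For a positive integer $k$ let $|k|_2$ be the largest power of $2$ dividing $k$. Write a partition $\nu$ of $n$ as $\nu=1^{n_1}2^{n_2}3^{n_3}\cdots$, where $n_i$ is the number of parts equal to $i$, put $d=|\gcd(n_1,n_2,\dots)|_2$, and set $\sigma_\nu=0$ if $|dq|_2>1$ and $\sigma_\nu=1$ otherwise. Then the number of real conjugacy classes of $PGL_n(q)=GL_n(q)/Z(GL_n(q))$ is $$\sum_{\nu\,:\,|\nu|=n}\frac{1}{2^{\sigma_\nu}}\prod_{i\,:\,n_i>0}n_{q,n_i},$$ the sum running over all partitions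 $\nu$ of $n$. Furthermore, every real conjugacy class of $PGL_n(q)$ is strongly real. -/

import Mathlib

open scoped MatrixGroups Polynomial

/-- `g` is real if some `h` in the group satisfies `h g h⁻¹ = g⁻¹`. -/
def IsRealElement {G : Type*} [Group G] (g : G) : Prop :=
  ∃ h : G, h * g * h⁻¹ = g⁻¹

/-- `g` is strongly real if some `h` with `h² = 1` satisfies `h g h⁻¹ = g⁻¹`. -/
def IsStronglyRealElement {G : Type*} [Group G] (g : G) : Prop :=
  ∃ h : G, h ^ 2 = 1 ∧ h * g * h⁻¹ = g⁻¹

/-- A conjugacy class is real if its elements are real. -/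
def IsRealClass {G : Type*} [Group G] (c : ConjClasses G) : Prop :=
  ∀ g ∈ c.carrier, IsRealElement g

/-- A conjugacy class is strongly real if its elements are strongly real. -/
def IsStronglyRealClass {G : Type*} [Group G] (c : ConjClasses G) : Prop :=
  ∀ g ∈ c.carrier, IsStronglyRealElement g

/-- The list of roots in the algebraic closure, with multiplicity, is closed under inversion.
This is only used for polynomials with nonzero constant term, which do not have the root `0`. -/
def IsSelfReciprocal {F : Type*} [Field F] (f : F[X]) : Prop :=
  (f.aroots (AlgebraicClosure F)).map (fun a => a⁻¹) = f.aroots (AlgebraicClosure F)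

/-- `n_{q,d}`: the number of self-reciprocal polynomials of degree `d` over the field `F` (with
`q` elements) whose constant term is `1`. -/
noncomputable def numSelfReciprocal (F : Type*) [Field F] (d : ℕ) : ℕ :=
  Nat.card {f : F[X] // f.natDegree = d ∧ f.eval 0 = 1 ∧ IsSelfReciprocal f}

/-- `|k|₂`: the largest power of `2` dividing the positive integer `k`. -/
def twoPart (k : ℕ) : ℕ := 2 ^ padicValNat 2 k

/-- For `ν = 1^{n_1} 2^{n_2} ⋯`, the `2`-part `d` of `gcd (n_1, n_2, …)`; here `n_i` is the number
of parts equal to `i`, which vanishes for `i > n`. -/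
def partitionD {n : ℕ} (ν : n.Partition) : ℕ :=
  twoPart ((Finset.Icc 1 n).gcd fun i => ν.parts.count i)

/-- `σ_ν` is `0` if `|d q|₂ > 1`, and `1` otherwise. -/
def partitionSigma (q : ℕ) {n : ℕ} (ν : n.Partition) : ℕ :=
  if 1 < twoPart (partitionD ν * q) then 0 else 1

open scoped LaurentPolynomial

section Chain

variable {R : Type*} [CommRing R]

/-- The isomorphism `R/I × R/J ≅ R/(I ⊔ J) × R/(I ⊓ J)` over a principal ideal domain. -/
theorem Ideal.nonempty_quotient_prod_equiv_sup_inf [IsDomain R] [IsPrincipalIdealRing R]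
    (I J : Ideal R) :
    Nonempty (((R ⧸ I) × (R ⧸ J)) ≃ₗ[R] ((R ⧸ (I ⊓ J)) × (R ⧸ (I ⊔ J)))) := by
  obtain ⟨a, hI⟩ : ∃ a, I = Ideal.span {a} := (IsPrincipalIdealRing.principal I).principal
  obtain ⟨b, hJ⟩ : ∃ b, J = Ideal.span {b} := (IsPrincipalIdealRing.principal J).principal
  by_cases h0 : a = 0 ∧ b = 0
  · obtain ⟨rfl, rfl⟩ := h0
    have hi : I ⊓ J = I := by rw [hI, hJ, inf_idem]
    have hs : I ⊔ J = J := by rw [hI, hJ, sup_idem]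
    rw [hi, hs]
    exact ⟨LinearEquiv.refl _ _⟩
  obtain ⟨g, hg⟩ := (IsPrincipalIdealRing.principal (I ⊔ J)).principal
  rw [Ideal.submodule_span_eq] at hg
  have ha : a ∈ I ⊔ J := Ideal.mem_sup_left (hI ▸ Ideal.mem_span_singleton_self a)
  have hb : b ∈ I ⊔ J := Ideal.mem_sup_right (hJ ▸ Ideal.mem_span_singleton_self b)
  have hgm : g ∈ I ⊔ J := hg ▸ Ideal.mem_span_singleton_self g
  rw [hg, Ideal.mem_span_singleton'] at ha hb
  obtain ⟨a', ha'⟩ := ha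
  obtain ⟨b', hb'⟩ := hb
  obtain ⟨u, hu, v, hv, huv⟩ := Submodule.mem_sup.1 hgm
  have memI : ∀ z, z ∈ I ↔ ∃ w, w * a = z := fun z => by rw [hI, Ideal.mem_span_singleton']
  have memJ : ∀ z, z ∈ J ↔ ∃ w, w * b = z := fun z => by rw [hJ, Ideal.mem_span_singleton']
  obtain ⟨x, rfl⟩ := (memI _).1 hu
  obtain ⟨y, rfl⟩ := (memJ _).1 hv
  have hg0 : g ≠ 0 := by
    rintro rfl
    exact h0 ⟨by simpa using ha'.symm, by simpa using hb'.symm⟩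
  have hbez : x * a' + y * b' = 1 := by
    apply mul_right_cancel₀ hg0
    linear_combination huv + x * ha' + y * hb'
  have hinfI : ∀ z ∈ I ⊓ J, z ∈ I := fun z hz => hz.1
  have hinfJ : ∀ z ∈ I ⊓ J, z ∈ J := fun z hz => hz.2
  have hl : ∀ z, b' * a * z ∈ I ⊓ J := fun z => by
    refine ⟨(memI _).2 ⟨b' * z, by ring⟩,
      (memJ _).2 ⟨a' * z, ?_⟩⟩
    linear_combination (z * a') * (-hb') + (b' * z) * ha'
  have hl' : ∀ z, a' * b * z ∈ I ⊓ J := fun z => by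
    have := hl z
    have e : a' * b * z = b' * a * z := by
      linear_combination (z * a') * (-hb') + (b' * z) * ha'
    rwa [e]
  have haa : ∀ z ∈ I ⊔ J, a' * z ∈ I := fun z hz => by
    rw [hg] at hz
    obtain ⟨w, rfl⟩ := Ideal.mem_span_singleton'.1 hz
    exact (memI _).2 ⟨w, by linear_combination (-w) * ha'⟩
  have hbb : ∀ z ∈ I ⊔ J, b' * z ∈ J := fun z hz => by
    rw [hg] at hz
    obtain ⟨w, rfl⟩ := Ideal.mem_span_singleton'.1 hz
    exact (memJ _).2 ⟨w, by linear_combination (-w) * hb'⟩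
  let f₁ : (R ⧸ I) × (R ⧸ J) →ₗ[R] R ⧸ (I ⊓ J) :=
    LinearMap.coprod
      (Submodule.mapQ I (I ⊓ J) (LinearMap.lsmul R R (-b')) (fun z hz => by
        obtain ⟨w, rfl⟩ := (memI _).1 hz
        have := hl (-w)
        simp only [Submodule.mem_comap, LinearMap.lsmul_apply, smul_eq_mul]
        convert this using 1; ring))
      (Submodule.mapQ J (I ⊓ J) (LinearMap.lsmul R R a') (fun z hz => by
        obtain ⟨w, rfl⟩ := (memJ _).1 hz
        have := hl' w
        simp only [Submodule.mem_comap, LinearMap.lsmul_apply, smul_eq_mul]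
        convert this using 1; ring))
  let f₂ : (R ⧸ I) × (R ⧸ J) →ₗ[R] R ⧸ (I ⊔ J) :=
    LinearMap.coprod
      (Submodule.mapQ I (I ⊔ J) (LinearMap.lsmul R R x)
        (fun z hz => (I ⊔ J).mul_mem_left _ (Ideal.mem_sup_left hz)))
      (Submodule.mapQ J (I ⊔ J) (LinearMap.lsmul R R y)
        (fun z hz => (I ⊔ J).mul_mem_left _ (Ideal.mem_sup_right hz)))
  let g₁ : (R ⧸ (I ⊓ J)) × (R ⧸ (I ⊔ J)) →ₗ[R] R ⧸ I :=
    LinearMap.coprod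
      (Submodule.mapQ (I ⊓ J) I (LinearMap.lsmul R R (-y))
        (fun z hz => I.mul_mem_left _ (hinfI z hz)))
      (Submodule.mapQ (I ⊔ J) I (LinearMap.lsmul R R a') (fun z hz => haa z hz))
  let g₂ : (R ⧸ (I ⊓ J)) × (R ⧸ (I ⊔ J)) →ₗ[R] R ⧸ J :=
    LinearMap.coprod
      (Submodule.mapQ (I ⊓ J) J (LinearMap.lsmul R R x)
        (fun z hz => J.mul_mem_left _ (hinfJ z hz)))
      (Submodule.mapQ (I ⊔ J) J (LinearMap.lsmul R R b') (fun z hz => hbb z hz))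
  refine ⟨LinearEquiv.ofLinearMap (f₁.prod f₂) (g₁.prod g₂) ?_ ?_⟩
  · refine LinearMap.ext ?_
    rintro ⟨r, s⟩
    obtain ⟨r, rfl⟩ := Submodule.Quotient.mk_surjective _ r
    obtain ⟨s, rfl⟩ := Submodule.Quotient.mk_surjective _ s
    refine Prod.ext ?_ ?_
    · change (Submodule.Quotient.mk (-b' * (-y * r + a' * s) + a' * (x * r + b' * s)) : R ⧸ (I ⊓ J)) =
        Submodule.Quotient.mk r
      exact congrArg _ (by linear_combination r * hbez)
    · change (Submodule.Quotient.mk (x * (-y * r + a' * s) + y * (x * r + b' * s)) : R ⧸ (I ⊔ J)) =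
        Submodule.Quotient.mk s
      exact congrArg _ (by linear_combination s * hbez)
  · refine LinearMap.ext ?_
    rintro ⟨r, s⟩
    obtain ⟨r, rfl⟩ := Submodule.Quotient.mk_surjective _ r
    obtain ⟨s, rfl⟩ := Submodule.Quotient.mk_surjective _ s
    refine Prod.ext ?_ ?_
    · change (Submodule.Quotient.mk (-y * (-b' * r + a' * s) + a' * (x * r + y * s)) : R ⧸ I) =
        Submodule.Quotient.mk r
      exact congrArg _ (by linear_combination r * hbez)
    · change (Submodule.Quotient.mk (x * (-b' * r + a' * s) + b' * (x * r + y * s)) : R ⧸ J) =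
        Submodule.Quotient.mk s
      exact congrArg _ (by linear_combination s * hbez)

/-- A cyclic module can be inserted into a sum of cyclic modules whose annihilators
form a chain. -/
theorem Ideal.exists_monotone_insert [IsDomain R] [IsPrincipalIdealRing R] :
    ∀ (n : ℕ) (J : Ideal R) (I : Fin n → Ideal R), Monotone I →
      ∃ I' : Fin (n + 1) → Ideal R, Monotone I' ∧
        (∀ K : Ideal R, K ≤ J → (∀ i, K ≤ I i) → ∀ i, K ≤ I' i) ∧
        Nonempty (((R ⧸ J) × (∀ i, R ⧸ I i)) ≃ₗ[R] (∀ i, R ⧸ I' i)) := by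
  intro n
  induction n with
  | zero =>
    intro J I _
    refine ⟨fun _ => J, fun _ _ _ => le_rfl, fun K hK _ _ => hK, ⟨?_⟩⟩
    exact (LinearEquiv.prodUnique : ((R ⧸ J) × (∀ i, R ⧸ I i)) ≃ₗ[R] R ⧸ J).trans
      (LinearEquiv.funUnique (Fin 1) R (R ⧸ J)).symm
  | succ n ih =>
    intro J I hI
    obtain ⟨I', hm, hb, ⟨e⟩⟩ := ih (J ⊔ I 0) (fun i => I i.succ)
      (fun i j h => hI (Fin.succ_le_succ_iff.2 h))
    obtain ⟨s⟩ := Ideal.nonempty_quotient_prod_equiv_sup_inf J (I 0)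
    have hle : ∀ i, J ⊓ I 0 ≤ I' i := hb _ (inf_le_left.trans le_sup_left)
      (fun i => inf_le_right.trans (hI (Fin.zero_le _)))
    refine ⟨Fin.cons (J ⊓ I 0) I', ?_, ?_, ⟨?_⟩⟩
    · intro i j h
      induction i using Fin.cases with
      | zero =>
        induction j using Fin.cases with
        | zero => exact le_rfl
        | succ j => simpa using hle j
      | succ i =>
        induction j using Fin.cases with
        | zero => exact absurd h (by simp)
        | succ j => simpa using hm (Fin.succ_le_succ_iff.1 h)
    · intro K hK hK' i
      induction i using Fin.cases with
      | zero => exact le_inf hK (hK' 0)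
      | succ i => simpa using hb K (hK.trans le_sup_left) (fun i => hK' i.succ) i
    · let e₁ : (∀ i, R ⧸ I i) ≃ₗ[R] (R ⧸ I 0) × (∀ i : Fin n, R ⧸ I i.succ) :=
        (Fin.consLinearEquiv R (fun i => R ⧸ I i)).symm
      let e₂ : ((R ⧸ (J ⊓ I 0)) × (∀ i, R ⧸ I' i)) ≃ₗ[R]
          (∀ i, R ⧸ (Fin.cons (J ⊓ I 0) I' : Fin (n + 2) → Ideal R) i) :=
        Fin.consLinearEquiv R (fun i => R ⧸ (Fin.cons (J ⊓ I 0) I' : Fin (n + 2) → Ideal R) i)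
      let e₃ := (LinearEquiv.prodCongr (LinearEquiv.refl R (R ⧸ J)) e₁).trans
        (LinearEquiv.prodAssoc R (R ⧸ J) (R ⧸ I 0) (∀ i : Fin n, R ⧸ I i.succ)).symm
      let e₄ := (LinearEquiv.prodCongr s (LinearEquiv.refl R (∀ i : Fin n, R ⧸ I i.succ))).trans
        (LinearEquiv.prodAssoc R _ _ _)
      exact ((e₃.trans e₄).trans (LinearEquiv.prodCongr (LinearEquiv.refl R _) e)).trans e₂

/-- A finite sum of cyclic modules over a principal ideal domain is isomorphic to one whose
annihilators form a chain. -/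
theorem Ideal.exists_monotone_pi_equiv [IsDomain R] [IsPrincipalIdealRing R] :
    ∀ (n : ℕ) (J : Fin n → Ideal R), ∃ I : Fin n → Ideal R, Monotone I ∧
        (∀ K : Ideal R, (∀ i, K ≤ J i) → ∀ i, K ≤ I i) ∧
        Nonempty ((∀ i, R ⧸ J i) ≃ₗ[R] (∀ i, R ⧸ I i)) := by
  intro n
  induction n with
  | zero => exact fun J => ⟨J, fun i => i.elim0, fun _ h => h, ⟨LinearEquiv.refl _ _⟩⟩
  | succ n ih =>
    intro J
    obtain ⟨I, hm, hb, ⟨e⟩⟩ := ih (fun i => J i.succ)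
    obtain ⟨I', hm', hb', ⟨e'⟩⟩ := Ideal.exists_monotone_insert n (J 0) I hm
    refine ⟨I', hm', fun K hK => hb' K (hK 0) (hb K fun i => hK i.succ), ⟨?_⟩⟩
    let e₁ : (∀ i, R ⧸ J i) ≃ₗ[R] (R ⧸ J 0) × (∀ i : Fin n, R ⧸ J i.succ) :=
      (Fin.consLinearEquiv R (fun i => R ⧸ J i)).symm
    exact (e₁.trans (LinearEquiv.prodCongr (LinearEquiv.refl R _) e)).trans e'

theorem Ideal.mem_iff_exists_span_eq_range_lsmul {n : ℕ} {I : Fin n → Ideal R} (hI : Monotone I)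
    {M : Type*} [AddCommGroup M] [Module R M] (e : M ≃ₗ[R] ∀ i, R ⧸ I i) (k : Fin n) (a : R) :
    a ∈ I k ↔ ∃ s : Fin k → M, Submodule.span R (Set.range s) = LinearMap.range
      (LinearMap.lsmul R M a) := by
  classical
  constructor
  · intro ha
    refine ⟨fun i => a • e.symm (Pi.single (i.castLE k.2.le) 1), le_antisymm ?_ ?_⟩
    · rw [Submodule.span_le]
      rintro _ ⟨i, rfl⟩
      exact ⟨_, rfl⟩
    · rintro _ ⟨m, rfl⟩
      obtain ⟨v, rfl⟩ := e.symm.surjective m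
      have hv : v = ∑ i, Pi.single i (v i) := (Finset.univ_sum_single v).symm
      rw [hv, map_sum, map_sum]
      refine Submodule.sum_mem _ fun i _ => ?_
      obtain ⟨r, hr⟩ := Ideal.Quotient.mk_surjective (v i)
      have h1 : (Pi.single i (v i) : ∀ i, R ⧸ I i) = r • Pi.single i 1 := by
        rw [← Pi.single_smul, ← hr, Algebra.smul_def, mul_one]
        rfl
      rw [h1, map_smul, map_smul]
      refine Submodule.smul_mem _ _ ?_
      by_cases hik : i < k
      · exact Submodule.subset_span ⟨⟨i, hik⟩, rfl⟩
      · have h2 : a • (Pi.single i 1 : ∀ i, R ⧸ I i) = 0 := by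
          rw [← Pi.single_smul, Algebra.smul_def, mul_one]
          have : algebraMap R (R ⧸ I i) a = 0 :=
            Ideal.Quotient.eq_zero_iff_mem.2 (hI (not_lt.1 hik) ha)
          rw [this, Pi.single_zero]
        rw [LinearMap.lsmul_apply, ← map_smul, h2, map_zero]
        exact Submodule.zero_mem _
  · rintro ⟨s, hs⟩
    by_contra ha
    let C : Ideal R := (I k).colon {a}
    have hCmem : ∀ x, x ∈ C ↔ x * a ∈ I k := fun x => by
      simp [C, Submodule.mem_colon_singleton]
    have hC : C ≠ ⊤ := fun h => ha (by
      have := (hCmem 1).1 (h ▸ Submodule.mem_top)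
      simpa using this)
    obtain ⟨m, hm, hCm⟩ := Ideal.exists_le_maximal C hC
    let := Ideal.Quotient.field m
    have hs' : ∀ i, ∃ x, a • x = s i := fun i => by
      have : s i ∈ LinearMap.range (LinearMap.lsmul R M a) :=
        hs ▸ Submodule.subset_span ⟨i, rfl⟩
      obtain ⟨x, hx⟩ := this
      exact ⟨x, hx⟩
    choose x hx using hs'
    have hlift : ∀ z : M, ∃ w : Fin n → R, ∀ i, Ideal.Quotient.mk (I i) (w i) = e z i :=
      fun z => ⟨fun i => (Ideal.Quotient.mk_surjective (e z i)).choose,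
        fun i => (Ideal.Quotient.mk_surjective (e z i)).choose_spec⟩
    choose w hw using hlift
    let c : Fin k → (Fin (k + 1) → R ⧸ m) := fun i j =>
      Ideal.Quotient.mk m (w (x i) (j.castLE k.2))
    have hspan : Submodule.span (R ⧸ m) (Set.range c) = ⊤ := by
      rw [eq_top_iff]
      rintro v -
      have hv : ∀ j, ∃ r, Ideal.Quotient.mk m r = v j := fun j => Ideal.Quotient.mk_surjective _
      choose r hr using hv
      let z : M := e.symm (fun i => Ideal.Quotient.mk (I i)
        (if h : (i : ℕ) < k + 1 then r ⟨i, h⟩ else 0))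
      have hz : a • z ∈ Submodule.span R (Set.range s) := hs ▸ ⟨z, rfl⟩
      obtain ⟨b, hb⟩ := (Submodule.mem_span_range_iff_exists_fun R).1 hz
      rw [Submodule.mem_span_range_iff_exists_fun]
      refine ⟨fun i => Ideal.Quotient.mk m (b i), ?_⟩
      ext j
      have h1 := congrFun (congrArg e hb) (j.castLE k.2)
      have hzj : e z (j.castLE k.2) = Ideal.Quotient.mk _ (r j) := by
        have h : (j : ℕ) < k + 1 := j.2
        simp only [z, LinearEquiv.apply_symm_apply, Fin.val_castLE, dif_pos h]
      have h2 : Ideal.Quotient.mk (I (j.castLE k.2)) (∑ i, b i * (a * w (x i) (j.castLE k.2)))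
          = Ideal.Quotient.mk (I (j.castLE k.2)) (a * r j) := by
        rw [map_smul, Pi.smul_apply, hzj, map_sum, Finset.sum_apply] at h1
        refine Eq.trans ?_ h1
        rw [map_sum]
        refine Finset.sum_congr rfl fun i _ => ?_
        rw [← hx, map_smul, map_smul, Pi.smul_apply, Pi.smul_apply, ← hw]
        rfl
      rw [Ideal.Quotient.eq] at h2
      have h3 : (∑ i, b i * w (x i) (j.castLE k.2)) - r j ∈ C := by
        rw [hCmem]
        have hjk : j.castLE k.2 ≤ k := Fin.le_def.2 (Nat.lt_succ_iff.1 j.2)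
        refine hI hjk ?_
        convert h2 using 1
        rw [sub_mul, Finset.sum_mul, mul_comm a]
        congr 1
        exact Finset.sum_congr rfl fun i _ => by ring
      have h4 := Ideal.Quotient.eq.2 (hCm h3)
      simp only [Finset.sum_apply, Pi.smul_apply, smul_eq_mul, c]
      rw [← hr, ← h4, map_sum]
      simp
    have h5 := finrank_range_le_card (R := R ⧸ m) c
    rw [Set.finrank, hspan, finrank_top] at h5
    simp at h5

/-- The annihilator chain of a finite sum of cyclic modules is determined by the module. -/
theorem Ideal.eq_of_monotone_of_pi_equiv {n : ℕ} {I J : Fin n → Ideal R} (hI : Monotone I)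
    (hJ : Monotone J) (e : (∀ i, R ⧸ I i) ≃ₗ[R] ∀ i, R ⧸ J i) : I = J := by
  ext k a
  rw [Ideal.mem_iff_exists_span_eq_range_lsmul hI (LinearEquiv.refl _ _),
    Ideal.mem_iff_exists_span_eq_range_lsmul hJ e]

end Chain

namespace LaurentPolynomial

section Eval

variable {F A : Type*} [Field F] [Ring A] [Algebra F A]

/-- Evaluation of Laurent polynomials at a unit of an algebra. -/
noncomputable def aevalUnit (x : Aˣ) : F[T;T⁻¹] →ₐ[F] A :=
  AddMonoidAlgebra.lift F A ℤ ((Units.coeHom A).comp (zpowersHom Aˣ x))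

@[simp]
theorem aevalUnit_T (x : Aˣ) (n : ℤ) : aevalUnit (F := F) x (T n) = (x ^ n : Aˣ) := by
  rw [aevalUnit, T, AddMonoidAlgebra.lift_single]
  simp

theorem aevalUnit_toLaurent (x : Aˣ) (p : F[X]) :
    aevalUnit x (Polynomial.toLaurent p) = Polynomial.aeval (x : A) p := by
  have : (aevalUnit x).comp Polynomial.toLaurentAlg = Polynomial.aeval (R := F) (x : A) := by
    apply Polynomial.algHom_ext
    simp
  exact DFunLike.congr_fun this p

theorem algHom_ext_T {f g : F[T;T⁻¹] →ₐ[F] A} (h : f (T 1) = g (T 1)) : f = g := by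
  have hneg : f (T (-1)) = g (T (-1)) := by
    have h1 : T (-1) * T 1 = (1 : F[T;T⁻¹]) := by rw [← T_add]; simp
    have h2 : T 1 * T (-1) = (1 : F[T;T⁻¹]) := by rw [← T_add]; simp
    calc f (T (-1)) = f (T (-1)) * (g (T 1) * g (T (-1))) := by
          rw [← map_mul g, h2, map_one, mul_one]
      _ = g (T (-1)) := by rw [← h, ← mul_assoc, ← map_mul f, h1, map_one, one_mul]
  have hnat : ∀ n : ℕ, f (T n) = g (T n) := fun n => by
    have : T (n : ℤ) = (T 1 : F[T;T⁻¹]) ^ n := by rw [T_pow, mul_one]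
    rw [this, map_pow, map_pow, h]
  have hnat' : ∀ n : ℕ, f (T (-n)) = g (T (-n)) := fun n => by
    have : T (-n : ℤ) = (T (-1) : F[T;T⁻¹]) ^ n := by rw [T_pow, mul_neg_one]
    rw [this, map_pow, map_pow, hneg]
  refine AlgHom.ext fun p => ?_
  obtain ⟨n, f', hf⟩ := exists_T_pow p
  have hp : p = Polynomial.toLaurent f' * T (-n) := by rw [hf, mul_assoc, ← T_add]; simp
  have hpoly : f.comp Polynomial.toLaurentAlg = g.comp Polynomial.toLaurentAlg := by
    apply Polynomial.algHom_ext
    simpa using h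
  rw [hp, map_mul, map_mul, hnat']
  congr 1
  exact DFunLike.congr_fun hpoly f'

end Eval

variable {F : Type*} [Field F]

instance : IsPrincipalIdealRing F[T;T⁻¹] where
  principal I := by
    obtain ⟨a, ha⟩ := (IsPrincipalIdealRing.principal (I.under F[X])).principal
    refine ⟨algebraMap F[X] F[T;T⁻¹] a, ?_⟩
    have h := IsLocalization.map_under (Submonoid.powers (Polynomial.X : F[X])) F[T;T⁻¹] I
    rw [ha] at h
    rw [← h, Ideal.submodule_span_eq, Ideal.map_span, Set.image_singleton]

theorem exists_eq_one_add_X_mul {f : F[X]} (hf : f.eval 0 = 1) :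
    ∃ g : F[X], f = 1 + Polynomial.X * g := by
  have : Polynomial.X ∣ f - 1 := by
    rw [Polynomial.X_dvd_iff, Polynomial.coeff_zero_eq_eval_zero]
    simp [hf]
  obtain ⟨g, hg⟩ := this
  exact ⟨g, by rw [← hg]; ring⟩

theorem toLaurent_dvd_toLaurent_iff {f p : F[X]} (hf : f.eval 0 = 1) :
    Polynomial.toLaurent f ∣ Polynomial.toLaurent p ↔ f ∣ p := by
  refine ⟨?_, fun h => map_dvd _ h⟩
  rintro ⟨q, hq⟩
  obtain ⟨n, q', hq'⟩ := exists_T_pow q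
  have h1 : p * Polynomial.X ^ n = f * q' := by
    apply Polynomial.toLaurent_injective
    rw [map_mul, map_mul, hq', hq, Polynomial.toLaurent_X_pow, mul_assoc]
  obtain ⟨g, hg⟩ := exists_eq_one_add_X_mul hf
  have hc : IsCoprime f (Polynomial.X ^ n) := by
    refine IsCoprime.pow_right ⟨1, -g, ?_⟩
    rw [hg]; ring
  exact hc.dvd_of_dvd_mul_right ⟨q', h1⟩

/-- The ideal of Laurent polynomials generated by a polynomial. -/
noncomputable def spanOf (f : F[X]) : Ideal F[T;T⁻¹] := Ideal.span {Polynomial.toLaurent f}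

theorem spanOf_ne_bot {f : F[X]} (hf : f.eval 0 = 1) : spanOf f ≠ ⊥ := by
  rw [spanOf, Ne, Ideal.span_singleton_eq_bot, Polynomial.toLaurent_eq_zero]
  rintro rfl
  simp at hf

theorem spanOf_injOn {f g : F[X]} (hf : f.eval 0 = 1) (hg : g.eval 0 = 1)
    (h : spanOf f = spanOf g) : f = g := by
  have h1 : f ∣ g := (toLaurent_dvd_toLaurent_iff hf).1
    (Ideal.span_singleton_le_span_singleton.1 h.ge)
  have h2 : g ∣ f := (toLaurent_dvd_toLaurent_iff hg).1
    (Ideal.span_singleton_le_span_singleton.1 h.le)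
  obtain ⟨u, hu⟩ := associated_of_dvd_dvd h1 h2
  obtain ⟨r, -, hr⟩ := Polynomial.isUnit_iff.1 u.isUnit
  rw [← hr] at hu
  have := congrArg (Polynomial.eval 0) hu
  rw [Polynomial.eval_mul, Polynomial.eval_C, hf, hg, one_mul] at this
  rw [← hu, this, Polynomial.C_1, mul_one]

theorem exists_eq_spanOf {I : Ideal F[T;T⁻¹]} (hI : I ≠ ⊥) :
    ∃ f : F[X], f.eval 0 = 1 ∧ I = spanOf f := by
  obtain ⟨q, hq⟩ : ∃ q, I = Ideal.span {q} := (IsPrincipalIdealRing.principal I).principal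
  obtain ⟨n, q', hq'⟩ := exists_T_pow q
  have hq0 : q' ≠ 0 := by
    rintro rfl
    apply hI
    rw [hq, Ideal.span_singleton_eq_bot]
    rw [map_zero] at hq'
    exact ((isUnit_T (R := F) (n : ℤ)).mul_left_eq_zero).1 hq'.symm
  obtain ⟨r, hr, hr0⟩ := Polynomial.exists_eq_pow_rootMultiplicity_mul_and_not_dvd q' hq0 0
  rw [Polynomial.C_0, sub_zero] at hr hr0
  have hr1 : r.eval 0 ≠ 0 := by
    rwa [Polynomial.X_dvd_iff, Polynomial.coeff_zero_eq_eval_zero] at hr0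
  refine ⟨Polynomial.C (r.eval 0)⁻¹ * r, by simp [hr1], ?_⟩
  have hqr : q = Polynomial.toLaurent (Polynomial.C (r.eval 0)⁻¹ * r) *
      (C (r.eval 0) * T (q'.rootMultiplicity 0 - n)) := by
    have h1 : q = Polynomial.toLaurent q' * T (-n) := by
      rw [hq', mul_assoc, ← T_add]; simp
    have h2 : (C (r.eval 0)⁻¹ : F[T;T⁻¹]) * C (r.eval 0) = 1 := by
      rw [← map_mul, inv_mul_cancel₀ hr1, map_one]
    nth_rewrite 1 [h1, hr]
    rw [map_mul, map_mul, Polynomial.toLaurent_X_pow, Polynomial.toLaurent_C, T_sub]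
    linear_combination (-(Polynomial.toLaurent r * T (q'.rootMultiplicity 0) * T (-n))) * h2
  have hu : IsUnit (C (r.eval 0) * T (q'.rootMultiplicity 0 - n) : F[T;T⁻¹]) :=
    ((Ne.isUnit hr1).map _).mul (isUnit_T _)
  rw [hq, hqr, spanOf]
  exact Ideal.span_singleton_mul_right_unit hu _

theorem mk_toLaurent_surjective {f : F[X]} (hf : f.eval 0 = 1) : Function.Surjective
    ((Ideal.Quotient.mkₐ F (spanOf f)).comp Polynomial.toLaurentAlg) := by
  obtain ⟨g, hg⟩ := exists_eq_one_add_X_mul hf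
  set φ := (Ideal.Quotient.mkₐ F (spanOf f)).comp Polynomial.toLaurentAlg with hφ
  have hneg : φ (-g) = Ideal.Quotient.mkₐ F (spanOf f) (T (-1)) := by
    have h0 : Ideal.Quotient.mk (spanOf f) (Polynomial.toLaurent f) = 0 :=
      Ideal.Quotient.eq_zero_iff_mem.2 (Ideal.mem_span_singleton_self _)
    have h1 : Polynomial.toLaurent (-g) = T (-1) - T (-1) * Polynomial.toLaurent f := by
      rw [hg, map_add, map_mul, map_neg, map_one, Polynomial.toLaurent_X, mul_add, ← mul_assoc,
        ← T_add]
      simp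
    change Ideal.Quotient.mk (spanOf f) (Polynomial.toLaurent (-g)) = Ideal.Quotient.mk _ _
    rw [h1, map_sub, map_mul, h0, mul_zero, sub_zero]
  intro y
  obtain ⟨p, rfl⟩ := Ideal.Quotient.mkₐ_surjective F (spanOf f) y
  obtain ⟨n, f', hf'⟩ := exists_T_pow p
  have hp : p = Polynomial.toLaurent f' * T (-1) ^ n := by
    rw [hf', mul_assoc, T_pow, ← T_add]; simp
  refine ⟨f' * (-g) ^ n, ?_⟩
  rw [map_mul, map_pow, hneg, hp, map_mul, map_pow]
  rfl

noncomputable def quotientSpanOfEquiv {f : F[X]} (hf : f.eval 0 = 1) :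
    (F[X] ⧸ Ideal.span {f}) ≃ₐ[F] (F[T;T⁻¹] ⧸ spanOf f) :=
  (Ideal.quotientEquivAlgOfEq F (by
    ext p
    rw [RingHom.mem_ker, Ideal.mem_span_singleton, ← toLaurent_dvd_toLaurent_iff hf,
      ← Ideal.mem_span_singleton]
    exact Ideal.Quotient.eq_zero_iff_mem.symm)).trans
  (Ideal.quotientKerAlgEquivOfSurjective (mk_toLaurent_surjective hf))

theorem finrank_quotient_spanOf {f : F[X]} (hf : f.eval 0 = 1) :
    Module.finrank F (F[T;T⁻¹] ⧸ spanOf f) = f.natDegree := by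
  rw [← (quotientSpanOfEquiv hf).toLinearEquiv.finrank_eq, finrank_quotient_span_eq_natDegree]

theorem finite_quotient {I : Ideal F[T;T⁻¹]} (hI : I ≠ ⊥) : Module.Finite F (F[T;T⁻¹] ⧸ I) := by
  obtain ⟨f, hf, rfl⟩ := exists_eq_spanOf hI
  have hf0 : f ≠ 0 := by rintro rfl; simp at hf
  have : Module.Finite F (F[X] ⧸ Ideal.span {f}) :=
    (AdjoinRoot.powerBasis hf0).finite
  exact Module.Finite.equiv (quotientSpanOfEquiv hf).toLinearEquiv

theorem finrank_quotient_mul {I J : Ideal F[T;T⁻¹]} (hI : I ≠ ⊥) (hJ : J ≠ ⊥) :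
    Module.finrank F (F[T;T⁻¹] ⧸ I * J) =
      Module.finrank F (F[T;T⁻¹] ⧸ I) + Module.finrank F (F[T;T⁻¹] ⧸ J) := by
  obtain ⟨f, hf, rfl⟩ := exists_eq_spanOf hI
  obtain ⟨g, hg, rfl⟩ := exists_eq_spanOf hJ
  have h : spanOf f * spanOf g = spanOf (f * g) := by
    simp [spanOf, Ideal.span_singleton_mul_span_singleton]
  rw [h, finrank_quotient_spanOf hf, finrank_quotient_spanOf hg,
    finrank_quotient_spanOf (by simp [hf, hg]), Polynomial.natDegree_mul]
  · rintro rfl; simp at hf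
  · rintro rfl; simp at hg

theorem finrank_quotient_eq_zero_iff {I : Ideal F[T;T⁻¹]} (hI : I ≠ ⊥) :
    Module.finrank F (F[T;T⁻¹] ⧸ I) = 0 ↔ I = ⊤ := by
  have := finite_quotient hI
  rw [Module.finrank_zero_iff, Ideal.Quotient.subsingleton_iff]

/-- The unit `c⁻¹ T⁻¹`. -/
noncomputable def twistUnit (c : Fˣ) : (F[T;T⁻¹])ˣ where
  val := C (c⁻¹ : F) * T (-1)
  inv := C (c : F) * T 1
  val_inv := by
    rw [mul_mul_mul_comm, ← map_mul, ← T_add]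
    simp
  inv_val := by
    rw [mul_mul_mul_comm, ← map_mul, ← T_add]
    simp

theorem aevalUnit_twistUnit_involutive (c : Fˣ) :
    (aevalUnit (twistUnit c)).comp (aevalUnit (twistUnit c)) = AlgHom.id F F[T;T⁻¹] := by
  apply algHom_ext_T
  have h : (c⁻¹ : F) * c = 1 := by simp
  have h1 : aevalUnit (F := F) (twistUnit c) (T (-1)) = C (c : F) * T 1 := by
    rw [aevalUnit_T, zpow_neg_one]
    rfl
  have h2 : aevalUnit (F := F) (twistUnit c) (T 1) = C (c⁻¹ : F) * T (-1) := by
    rw [aevalUnit_T, zpow_one]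
    rfl
  rw [AlgHom.comp_apply, h2, map_mul, h1, C_eq_algebraMap, AlgHom.commutes, ← mul_assoc,
    ← C_eq_algebraMap, ← map_mul, h, map_one, one_mul, AlgHom.id_apply]

/-- The involution `T ↦ c⁻¹ T⁻¹` of the ring of Laurent polynomials. -/
noncomputable def twist (c : Fˣ) : F[T;T⁻¹] ≃ₐ[F] F[T;T⁻¹] :=
  AlgEquiv.ofAlgHom (aevalUnit (twistUnit c)) (aevalUnit (twistUnit c))
    (aevalUnit_twistUnit_involutive c) (aevalUnit_twistUnit_involutive c)

@[simp]
theorem twist_twist (c : Fˣ) (p : F[T;T⁻¹]) : twist c (twist c p) = p :=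
  (twist c).symm_apply_apply p

theorem twist_T_one (c : Fˣ) : twist c (T 1) = C (c⁻¹ : F) * T (-1) := by
  change aevalUnit (F := F) (twistUnit c) (T 1) = _
  rw [aevalUnit_T, zpow_one]
  rfl

/-- The polynomial `t^d f(1/(ct))`, where `d` is the degree of `f`. -/
noncomputable def reciprocal (c : Fˣ) (f : F[X]) : F[X] :=
  (f.comp (Polynomial.C (c⁻¹ : F) * Polynomial.X)).reverse

theorem coeff_reciprocal (c : Fˣ) (f : F[X]) {i : ℕ} (hi : i ≤ f.natDegree) :
    (reciprocal c f).coeff i = f.coeff (f.natDegree - i) * (c⁻¹ : F) ^ (f.natDegree - i) := by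
  have hd : (f.comp (Polynomial.C (c⁻¹ : F) * Polynomial.X)).natDegree = f.natDegree := by
    rw [Polynomial.natDegree_comp, Polynomial.natDegree_C_mul_X _ (by simp), mul_one]
  rw [reciprocal, Polynomial.coeff_reverse, hd, Polynomial.revAt_le hi,
    Polynomial.comp_C_mul_X_coeff]

theorem natDegree_reciprocal_le (c : Fˣ) (f : F[X]) :
    (reciprocal c f).natDegree ≤ f.natDegree := by
  refine (Polynomial.reverse_natDegree_le _).trans ?_
  rw [Polynomial.natDegree_comp, Polynomial.natDegree_C_mul_X _ (by simp), mul_one]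

theorem toLaurent_reciprocal (c : Fˣ) (f : F[X]) :
    Polynomial.toLaurent (reciprocal c f) =
      twist c (Polynomial.toLaurent f) * T f.natDegree := by
  rw [reciprocal, toLaurent_reverse, Polynomial.natDegree_comp,
    Polynomial.natDegree_C_mul_X _ (by simp), mul_one]
  congr 1
  have : ((invert (R := F)).toAlgHom.comp Polynomial.toLaurentAlg).comp
      (Polynomial.aeval (Polynomial.C (c⁻¹ : F) * Polynomial.X)) =
      (twist c).toAlgHom.comp Polynomial.toLaurentAlg := by
    apply Polynomial.algHom_ext
    simp [twist_T_one]
  exact DFunLike.congr_fun this f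

theorem map_twist_spanOf (c : Fˣ) (f : F[X]) :
    (spanOf f).map (twist c) = spanOf (reciprocal c f) := by
  rw [spanOf, Ideal.map_span, Set.image_singleton, spanOf, toLaurent_reciprocal]
  exact (Ideal.span_singleton_mul_right_unit (isUnit_T _) _).symm

theorem map_twist_spanOf_eq_iff_eq_reciprocal (c : Fˣ) {f : F[X]} (hf : f.eval 0 = 1) :
    (spanOf f).map (twist c) = spanOf f ↔
      f = Polynomial.C f.leadingCoeff * reciprocal c f := by
  have hf0 : f ≠ 0 := by rintro rfl; simp at hf
  rw [map_twist_spanOf]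
  constructor
  · intro h
    obtain ⟨q, hq⟩ := (toLaurent_dvd_toLaurent_iff hf).1
      (Ideal.span_singleton_le_span_singleton.1 h.le)
    have hlead : (reciprocal c f).coeff f.natDegree = 1 := by
      rw [coeff_reciprocal c f le_rfl, Nat.sub_self, Polynomial.coeff_zero_eq_eval_zero, hf]
      simp
    have hq0 : q ≠ 0 := by
      rintro rfl
      rw [hq] at hlead
      simp at hlead
    have hdeg : q.natDegree = 0 := by
      have := natDegree_reciprocal_le c f
      rw [hq, Polynomial.natDegree_mul hf0 hq0] at this
      omega
    obtain ⟨r, rfl⟩ := Polynomial.natDegree_eq_zero.1 hdeg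
    rw [hq, Polynomial.coeff_mul_C] at hlead
    rw [hq, mul_left_comm, ← Polynomial.C_mul, Polynomial.leadingCoeff, hlead, Polynomial.C_1,
      mul_one]
  · intro h
    have hu : IsUnit (Polynomial.toLaurent (Polynomial.C f.leadingCoeff)) := by
      rw [Polynomial.toLaurent_C]
      exact (Ne.isUnit (Polynomial.leadingCoeff_ne_zero.2 hf0)).map _
    conv_rhs => rw [h, spanOf, map_mul]
    exact (Ideal.span_singleton_mul_left_unit hu _).symm

theorem map_twist_spanOf_eq_iff (c : Fˣ) {f : F[X]} (hf : f.eval 0 = 1) :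
    (spanOf f).map (twist c) = spanOf f ↔ ∀ i ≤ f.natDegree,
      f.coeff i * (c : F) ^ (f.natDegree - i) =
        f.coeff f.natDegree * f.coeff (f.natDegree - i) := by
  have hpow : ∀ k, (c⁻¹ : F) ^ k * (c : F) ^ k = 1 := fun k => by
    rw [← mul_pow]; simp
  rw [map_twist_spanOf_eq_iff_eq_reciprocal c hf]
  constructor
  · intro h i hi
    have := congrArg (fun p => Polynomial.coeff p i) h
    simp only [Polynomial.coeff_C_mul, coeff_reciprocal c f hi] at this
    rw [this, Polynomial.leadingCoeff]
    linear_combination f.coeff f.natDegree * f.coeff (f.natDegree - i) * hpow (f.natDegree - i)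
  · intro h
    ext i
    rw [Polynomial.coeff_C_mul]
    by_cases hi : i ≤ f.natDegree
    · rw [coeff_reciprocal c f hi, Polynomial.leadingCoeff, ← mul_assoc, ← h i hi, mul_assoc,
        mul_comm ((c : F) ^ _), hpow, mul_one]
    · rw [Polynomial.coeff_eq_zero_of_natDegree_lt (not_le.1 hi),
        Polynomial.coeff_eq_zero_of_natDegree_lt
          ((natDegree_reciprocal_le c f).trans_lt (not_le.1 hi)), mul_zero]

end LaurentPolynomial

namespace Polynomial

variable {K : Type*} [Field K]

theorem roots_reverse_prod_X_sub_C (s : Multiset K) (hs : (0 : K) ∉ s) :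
    ((s.map fun a => X - C a).prod.reverse).roots = s.map (·⁻¹) := by
  induction s using Multiset.induction_on with
  | empty =>
    rw [Multiset.map_zero, Multiset.map_zero, Multiset.prod_zero, ← C_1, reverse_C, roots_C]
  | cons a s ih =>
    rw [Multiset.mem_cons, not_or] at hs
    have ha : a ≠ 0 := fun h => hs.1 h.symm
    have hlin : (X - C a).reverse = C (-a) * (X - C a⁻¹) := by
      have h1 : (X - C a) = C 1 * X + C (-a) := by simp [sub_eq_add_neg]
      have hd : (X - C a).natDegree = 1 := natDegree_X_sub_C a
      ext i
      rw [coeff_reverse, hd]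
      rcases i with _ | _ | i
      · simp [ha, revAt_le]
      · simp [revAt_le]
      · rw [revAt_eq_self_of_lt (by omega)]
        simp [coeff_X]
    have hne : (s.map fun a => X - C a).prod ≠ 0 :=
      (monic_multiset_prod_of_monic _ _ fun b _ => monic_X_sub_C b).ne_zero
    rw [Multiset.map_cons, Multiset.prod_cons, reverse_mul_of_domain, hlin, mul_assoc,
      roots_C_mul _ (neg_ne_zero.2 ha), roots_mul, roots_X_sub_C, ih hs.2, Multiset.map_cons,
      Multiset.singleton_add]
    exact mul_ne_zero (X_sub_C_ne_zero _) (by rwa [Ne, reverse_eq_zero])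

theorem Splits.roots_reverse {p : K[X]} (hp : p.Splits) (h0 : p.eval 0 ≠ 0) :
    p.reverse.roots = p.roots.map (·⁻¹) := by
  have hp0 : p ≠ 0 := by rintro rfl; simp at h0
  have hr : (0 : K) ∉ p.roots := fun h => h0 (by simpa using (mem_roots hp0).1 h)
  conv_lhs => rw [hp.eq_prod_roots, reverse_mul_of_domain, reverse_C,
    roots_C_mul _ (leadingCoeff_ne_zero.2 hp0)]
  exact roots_reverse_prod_X_sub_C _ hr

theorem Splits.roots_reverse_eq_roots_iff {p : K[X]} (hp : p.Splits) (h0 : p.eval 0 = 1) :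
    p.reverse.roots = p.roots ↔ p = C p.leadingCoeff * p.reverse := by
  have hp0 : p ≠ 0 := by rintro rfl; simp at h0
  have hl : p.leadingCoeff ≠ 0 := leadingCoeff_ne_zero.2 hp0
  constructor
  · intro h
    have hc : p.coeff 0 = 1 := by rw [coeff_zero_eq_eval_zero, h0]
    have hd : p.reverse.natDegree = p.natDegree := by
      rw [reverse_natDegree, natTrailingDegree_eq_zero.2 (Or.inr (by rw [hc]; exact one_ne_zero)),
        Nat.sub_zero]
    have hlr : p.reverse.leadingCoeff = 1 := by
      rw [leadingCoeff, hd, coeff_reverse, revAt_le le_rfl, Nat.sub_self, hc]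
    have hcard : Multiset.card p.roots = p.natDegree := hp.natDegree_eq_card_roots.symm
    have h1 := C_leadingCoeff_mul_prod_multiset_X_sub_C (p := p.reverse) (by rw [h, hcard, hd])
    rw [h, hlr, C_1, one_mul] at h1
    rw [← h1]
    exact hp.eq_prod_roots
  · intro h
    conv_rhs => rw [h, roots_C_mul _ hl]

end Polynomial

theorem isSelfReciprocal_iff {F : Type*} [Field F] {f : F[X]} (hf : f.eval 0 = 1) :
    IsSelfReciprocal f ↔ f = Polynomial.C f.leadingCoeff * f.reverse := by
  set K := AlgebraicClosure F
  set i := algebraMap F K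
  have hs : (f.map i).Splits := IsAlgClosed.splits _
  have h0 : (f.map i).eval 0 = 1 := by
    rw [Polynomial.eval_zero_map, hf, map_one]
  have hrev : (f.map i).reverse = f.reverse.map i := by
    rw [Polynomial.reverse, Polynomial.reverse, Polynomial.reflect_map,
      Polynomial.natDegree_map]
  have hroots : (f.aroots K).map (fun a => a⁻¹) = (f.map i).reverse.roots :=
    (hs.roots_reverse (by rw [h0]; exact one_ne_zero)).symm
  rw [IsSelfReciprocal, hroots, Polynomial.aroots, hs.roots_reverse_eq_roots_iff h0, hrev,
    Polynomial.leadingCoeff_map, ← Polynomial.map_C, ← Polynomial.map_mul]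
  exact (Polynomial.map_injective i i.injective).eq_iff

namespace LaurentPolynomial

variable {F : Type*} [Field F]

theorem reciprocal_one (f : F[X]) : reciprocal 1 f = f.reverse := by
  simp [reciprocal]

/-- The number of nonzero ideals of codimension `d` of the ring of Laurent polynomials which are
stable under `T ↦ c⁻¹ T⁻¹`. -/
noncomputable def numStable (c : Fˣ) (d : ℕ) : ℕ :=
  Nat.card {I : Ideal F[T;T⁻¹] // I ≠ ⊥ ∧ Module.finrank F (F[T;T⁻¹] ⧸ I) = d ∧
    I.map (twist c) = I}

/-- The coefficient form of the condition that the ideal of `f` is stable under `twist c`. -/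
def IsStable (c : Fˣ) (d : ℕ) (f : F[X]) : Prop :=
  f.natDegree = d ∧ f.eval 0 = 1 ∧
    ∀ i ≤ d, f.coeff i * (c : F) ^ (d - i) = f.coeff d * f.coeff (d - i)

theorem numStable_eq_card_isStable (c : Fˣ) (d : ℕ) :
    numStable c d = Nat.card {f : F[X] // IsStable c d f} := by
  symm
  refine Nat.card_congr (Equiv.ofBijective (fun f => ⟨spanOf f.1, spanOf_ne_bot f.2.2.1, ?_, ?_⟩)
    ⟨?_, ?_⟩)
  · rw [finrank_quotient_spanOf f.2.2.1, f.2.1]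
  · rw [map_twist_spanOf_eq_iff c f.2.2.1, f.2.1]
    exact f.2.2.2
  · intro f g h
    exact Subtype.ext (spanOf_injOn f.2.2.1 g.2.2.1 (congrArg Subtype.val h))
  · rintro ⟨I, hI, hd, hI'⟩
    obtain ⟨f, hf, rfl⟩ := exists_eq_spanOf hI
    rw [finrank_quotient_spanOf hf] at hd
    rw [map_twist_spanOf_eq_iff c hf, hd] at hI'
    exact ⟨⟨f, hd, hf, hI'⟩, rfl⟩

theorem numStable_one (d : ℕ) : numStable (1 : Fˣ) d = numSelfReciprocal F d := by
  rw [numStable_eq_card_isStable, numSelfReciprocal]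
  refine Nat.card_congr (Equiv.subtypeEquivRight fun f => and_congr_right fun hd =>
    and_congr_right fun hf => ?_)
  rw [isSelfReciprocal_iff hf, ← hd, ← map_twist_spanOf_eq_iff 1 hf,
    map_twist_spanOf_eq_iff_eq_reciprocal 1 hf, reciprocal_one]

theorem finite_stable [Finite F] (d : ℕ) :
    Finite {I : Ideal F[T;T⁻¹] // I ≠ ⊥ ∧ Module.finrank F (F[T;T⁻¹] ⧸ I) = d} := by
  have : Finite (Polynomial.degreeLT F (d + 1)) :=
    Finite.of_equiv _ (Polynomial.degreeLTEquiv F (d + 1)).symm.toEquiv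
  refine Finite.of_injective (β := Polynomial.degreeLT F (d + 1))
    (fun I => ⟨(exists_eq_spanOf I.2.1).choose, ?_⟩) ?_
  · rw [Polynomial.mem_degreeLT]
    have h := (exists_eq_spanOf I.2.1).choose_spec
    have h1 := finrank_quotient_spanOf h.1
    rw [← h.2] at h1
    have h2 := h1.symm.trans I.2.2
    exact Polynomial.degree_le_natDegree.trans_lt (by exact_mod_cast (by omega))
  · intro I J h
    apply Subtype.ext
    rw [(exists_eq_spanOf I.2.1).choose_spec.2, (exists_eq_spanOf J.2.1).choose_spec.2]
    exact congrArg spanOf (congrArg Subtype.val h)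

/-- Multiply the `i`-th coefficient by `w i`. -/
noncomputable def weigh (w : ℕ → F) (f : F[X]) : F[X] :=
  ∑ i ∈ Finset.range (f.natDegree + 1), Polynomial.monomial i (w i * f.coeff i)

theorem coeff_weigh (w : ℕ → F) (f : F[X]) (i : ℕ) :
    (weigh w f).coeff i = w i * f.coeff i := by
  rw [weigh, Polynomial.finsetSum_coeff]
  simp only [Polynomial.coeff_monomial, Finset.sum_ite_eq', Finset.mem_range]
  split_ifs with h
  · rfl
  · rw [Polynomial.coeff_eq_zero_of_natDegree_lt (by omega), mul_zero]

theorem natDegree_weigh {w : ℕ → F} (hw : ∀ i, w i ≠ 0) (f : F[X]) :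
    (weigh w f).natDegree = f.natDegree := by
  have h : (weigh w f).support = f.support := by
    ext i
    simp [coeff_weigh, hw i]
  simp only [Polynomial.natDegree, Polynomial.degree, h]

theorem weigh_weigh {w w' : ℕ → F} (h : ∀ i, w i * w' i = 1) (f : F[X]) :
    weigh w (weigh w' f) = f := by
  ext i
  rw [coeff_weigh, coeff_weigh, ← mul_assoc, h, one_mul]

theorem isStable_weigh {c c' : Fˣ} {d : ℕ} {w : ℕ → F} (hw : ∀ i, w i ≠ 0) (hw0 : w 0 = 1)
    (h : ∀ i ≤ d, w i * (c' : F) ^ (d - i) = w d * w (d - i) * (c : F) ^ (d - i)) {f : F[X]}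
    (hf : IsStable c d f) : IsStable c' d (weigh w f) := by
  obtain ⟨hd, h0, hs⟩ := hf
  refine ⟨by rw [natDegree_weigh hw, hd], ?_, fun i hi => ?_⟩
  · rw [← Polynomial.coeff_zero_eq_eval_zero, coeff_weigh, hw0, one_mul,
      Polynomial.coeff_zero_eq_eval_zero, h0]
  · simp only [coeff_weigh]
    linear_combination f.coeff i * h i hi + w d * w (d - i) * hs i hi

theorem numStable_eq_of_weight {c : Fˣ} {d : ℕ} {w : ℕ → F} (hw : ∀ i, w i ≠ 0) (hw0 : w 0 = 1)
    (h : ∀ i ≤ d, w i * (c : F) ^ (d - i) = w d * w (d - i)) :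
    numStable c d = numStable (1 : Fˣ) d := by
  rw [numStable_eq_card_isStable, numStable_eq_card_isStable]
  have hw' : ∀ i, (w i)⁻¹ ≠ 0 := fun i => inv_ne_zero (hw i)
  symm
  refine Nat.card_congr
    { toFun := fun f => ⟨weigh w f.1, isStable_weigh hw hw0 (by simpa using h) f.2⟩
      invFun := fun f => ⟨weigh (fun i => (w i)⁻¹) f.1,
        isStable_weigh hw' (by simp [hw0]) (fun i hi => ?_) f.2⟩
      left_inv := fun f => Subtype.ext (weigh_weigh (fun i => inv_mul_cancel₀ (hw i)) _)
      right_inv := fun f => Subtype.ext (weigh_weigh (fun i => mul_inv_cancel₀ (hw i)) _) }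
  have h1 := hw i
  have h2 := hw d
  have h3 := hw (d - i)
  have h4 := h i hi
  rw [Units.val_one, one_pow, mul_one]
  field_simp
  exact h4.symm

theorem numStable_of_even (c : Fˣ) {d : ℕ} (hd : Even d) :
    numStable c d = numStable (1 : Fˣ) d := by
  obtain ⟨m, rfl⟩ := hd
  refine numStable_eq_of_weight (w := fun i => (c : F) ^ (i - m)) (fun i => by simp) (by simp)
    fun i hi => ?_
  rw [← pow_add, ← pow_add]
  congr 1
  omega

theorem numStable_sq (b : Fˣ) (d : ℕ) : numStable (b ^ 2) d = numStable (1 : Fˣ) d := by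
  refine numStable_eq_of_weight (w := fun i => (b : F) ^ i) (fun i => by simp) (by simp)
    fun i hi => ?_
  rw [Units.val_pow_eq_pow_val, ← pow_mul, ← pow_add, ← pow_add]
  congr 1
  omega

theorem numStable_eq_zero {c : Fˣ} (hc : ¬ IsSquare c) {d : ℕ} (hd : Odd d) :
    numStable c d = 0 := by
  rw [numStable_eq_card_isStable]
  have : IsEmpty {f : F[X] // IsStable c d f} := by
    refine ⟨?_⟩
    rintro ⟨f, hfd, h0, hs⟩
    apply hc
    obtain ⟨m, rfl⟩ := hd
    have h := hs 0 (Nat.zero_le _)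
    rw [Nat.sub_zero, Polynomial.coeff_zero_eq_eval_zero, h0, one_mul] at h
    have hl : f.coeff (2 * m + 1) ≠ 0 := fun h' => by simp [h'] at h
    refine ⟨Units.mk0 _ hl * (c ^ m)⁻¹, ?_⟩
    have hu : c ^ (2 * m + 1) = Units.mk0 _ hl * Units.mk0 _ hl := Units.ext (by simpa using h)
    rw [mul_mul_mul_comm, ← hu, ← mul_inv, ← pow_add, ← two_mul, pow_succ', mul_assoc,
      mul_inv_cancel, mul_one]
  exact Nat.card_of_isEmpty

theorem numStable_zero (c : Fˣ) : numStable c 0 = 1 := by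
  have h : ∀ I : Ideal F[T;T⁻¹], (I ≠ ⊥ ∧ Module.finrank F (F[T;T⁻¹] ⧸ I) = 0 ∧
      I.map (twist c) = I) ↔ I = ⊤ := by
    intro I
    constructor
    · rintro ⟨h1, h2, -⟩
      exact (finrank_quotient_eq_zero_iff h1).1 h2
    · rintro rfl
      exact ⟨top_ne_bot, (finrank_quotient_eq_zero_iff top_ne_bot).2 rfl, Ideal.map_top _⟩
  rw [numStable, Nat.card_congr (Equiv.subtypeEquivRight h)]
  exact Nat.card_unique

end LaurentPolynomial

theorem isRealClass_mk_iff {G : Type*} [Group G] (g : G) :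
    IsRealClass (ConjClasses.mk g) ↔ IsConj g g⁻¹ := by
  rw [isConj_iff]
  constructor
  · intro h
    exact h g ConjClasses.mem_carrier_mk
  · rintro ⟨k, hk⟩ g' hg'
    rw [ConjClasses.mem_carrier_iff_mk_eq, ConjClasses.mk_eq_mk_iff_isConj, isConj_iff] at hg'
    obtain ⟨l, rfl⟩ := hg'
    refine ⟨l⁻¹ * k * l, ?_⟩
    have : g'⁻¹ = l⁻¹ * (l * g' * l⁻¹)⁻¹ * l := by group
    rw [this, ← hk]
    group

namespace ConjClasses

variable {G A : Type*} [Group G] [CommGroup A]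

/-- Inversion of conjugacy classes. -/
def invClass : ConjClasses G → ConjClasses G :=
  Quotient.map' (fun g => g⁻¹) (by
    intro g h hgh
    change IsConj _ _ at hgh
    change IsConj _ _
    rw [isConj_iff] at hgh ⊢
    obtain ⟨k, rfl⟩ := hgh
    exact ⟨k, by group⟩)

/-- Multiplication of conjugacy classes by central elements. -/
abbrev centralAction (s : A →* G) (hs : ∀ a g, s a * g = g * s a) :
    MulAction A (ConjClasses G) where
  smul a := Quotient.map' (fun g => s a * g) (by
    intro g h hgh
    change IsConj _ _ at hgh
    change IsConj _ _
    rw [isConj_iff] at hgh ⊢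
    obtain ⟨k, rfl⟩ := hgh
    exact ⟨k, by rw [← mul_assoc k, ← hs]; group⟩)
  one_smul x := by
    induction x using Quotient.inductionOn' with
    | h g => exact congrArg ConjClasses.mk ((congrArg (· * g) s.map_one).trans (one_mul g))
  mul_smul a b x := by
    induction x using Quotient.inductionOn' with
    | h g => exact congrArg ConjClasses.mk ((congrArg (· * g) (s.map_mul a b)).trans (mul_assoc _ _ g))

theorem nonempty_sigma_smul_eq_equiv {X : Type*} [MulAction A X] (f : X → X) (x₀ : X)
    (hf : ∀ x ∈ MulAction.orbit A x₀, ∃ a : A, a • x = f x) :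
    Nonempty ((Σ x : MulAction.orbit A x₀, {a : A // a • (x : X) = f x}) ≃ A) := by
  refine ⟨Equiv.trans ?_ (MulAction.orbitProdStabilizerEquivGroup A x₀)⟩
  refine (Equiv.sigmaCongrRight fun x => ?_).trans (Equiv.sigmaEquivProd _ _)
  have h := (hf x.1 x.2).choose_spec
  set a₁ := (hf x.1 x.2).choose
  refine (Equiv.mulLeft a₁⁻¹).subtypeEquiv fun a => ?_
  obtain ⟨b, hb⟩ := x.2
  change b • x₀ = x.1 at hb
  change _ ↔ (a₁⁻¹ * a) • x₀ = x₀
  rw [← h, ← hb, mul_smul, inv_smul_eq_iff, smul_comm a, smul_comm a₁, smul_left_cancel_iff]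

theorem card_isRealClass_mul_card {Q : Type*} [Group Q]
    (s : A →* G) (hs : ∀ a g, s a * g = g * s a) (π : G →* Q) (hπ : Function.Surjective π)
    (hker : ∀ g h, π g = π h ↔ ∃ a, s a * g = h) :
    Nat.card {y : ConjClasses Q // IsRealClass y} * Nat.card A =
      Nat.card (Σ a : A, {x : ConjClasses G //
        (centralAction s hs).toSMul.smul a x = invClass x}) := by
  let := centralAction s hs
  have hsmul : ∀ (a : A) (g : G), a • ConjClasses.mk g = ConjClasses.mk (s a * g) :=
    fun _ _ => rfl
  let p : ConjClasses G → ConjClasses Q := ConjClasses.map π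
  have hpmk : ∀ g, p (ConjClasses.mk g) = ConjClasses.mk (π g) := fun _ => rfl
  have hp : ∀ x y, p x = p y ↔ ∃ a : A, a • x = y := by
    intro x y
    obtain ⟨g, rfl⟩ := ConjClasses.mk_surjective x
    obtain ⟨h, rfl⟩ := ConjClasses.mk_surjective y
    rw [hpmk, hpmk, ConjClasses.mk_eq_mk_iff_isConj, isConj_iff]
    constructor
    · rintro ⟨k, hk⟩
      obtain ⟨k, rfl⟩ := hπ k
      rw [← map_mul, ← map_inv, ← map_mul, hker] at hk
      obtain ⟨a, ha⟩ := hk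
      refine ⟨a, ?_⟩
      rw [hsmul, ConjClasses.mk_eq_mk_iff_isConj, isConj_iff]
      exact ⟨k, by rw [← ha, ← mul_assoc k, ← hs]; group⟩
    · rintro ⟨a, ha⟩
      rw [hsmul, ConjClasses.mk_eq_mk_iff_isConj, isConj_iff] at ha
      obtain ⟨k, rfl⟩ := ha
      have h1 : π g = π (s a * g) := (hker _ _).2 ⟨a, rfl⟩
      exact ⟨π k, by rw [map_mul, map_mul, map_inv, ← h1]⟩
  have hreal : ∀ x, IsRealClass (p x) ↔ ∃ a : A, a • x = invClass x := by
    intro x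
    obtain ⟨g, rfl⟩ := ConjClasses.mk_surjective x
    rw [hpmk, isRealClass_mk_iff, ← ConjClasses.mk_eq_mk_iff_isConj, ← map_inv, ← hpmk, ← hpmk,
      hp]
    rfl
  have hps : Function.Surjective p := by
    intro y
    obtain ⟨k, rfl⟩ := ConjClasses.mk_surjective y
    obtain ⟨g, rfl⟩ := hπ k
    exact ⟨ConjClasses.mk g, rfl⟩
  have hfiber : ∀ y : {y : ConjClasses Q // IsRealClass y},
      Nonempty ((Σ x : {x // p x = y.1}, {a : A // a • x.1 = invClass x.1}) ≃ A) := by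
    rintro ⟨y, hy⟩
    obtain ⟨x₀, rfl⟩ := hps y
    obtain ⟨h⟩ := nonempty_sigma_smul_eq_equiv (A := A) invClass x₀ (fun x hx => (hreal x).1 (by
      have : p x = p x₀ := ((hp _ _).2 hx).symm
      rwa [this]))
    have e : (Σ x : {x // p x = p x₀}, {a : A // a • x.1 = invClass x.1}) ≃
        Σ x : MulAction.orbit A x₀, {a : A // a • (x : ConjClasses G) = invClass x} :=
      (Equiv.subtypeEquivRight fun x => by
        rw [eq_comm, hp]; rfl).sigmaCongr fun _ => Equiv.refl _
    exact ⟨e.trans h⟩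
  rw [← Nat.card_prod]
  refine Nat.card_congr ?_
  refine (Equiv.sigmaEquivProd _ _).symm.trans ?_
  refine (Equiv.sigmaCongrRight fun y => (hfiber y).some.symm).trans ?_
  exact
    { toFun := fun t => ⟨t.2.2.1, t.2.1.1, t.2.2.2⟩
      invFun := fun t => ⟨⟨p t.2.1, (hreal _).2 ⟨t.1, t.2.2⟩⟩, ⟨t.2.1, rfl⟩, t.1, t.2.2⟩
      left_inv := by
        rintro ⟨⟨y, hy⟩, ⟨x, hx⟩, a, ha⟩
        change p x = y at hx
        subst hx
        rfl
      right_inv := by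
        rintro ⟨a, x, ha⟩
        rfl }

end ConjClasses

open LaurentPolynomial

section UnitModule

variable {F V : Type*} [Field F] [AddCommGroup V] [Module F V]

/-- A vector space, regarded as a module over Laurent polynomials through an automorphism. -/
def UnitModule (_ : (Module.End F V)ˣ) : Type _ := V

namespace UnitModule

variable (u : (Module.End F V)ˣ)

noncomputable instance : AddCommGroup (UnitModule u) := inferInstanceAs (AddCommGroup V)

noncomputable instance : Module F (UnitModule u) := inferInstanceAs (Module F V)

noncomputable instance : Module F[T;T⁻¹] (UnitModule u) :=
  Module.compHom V (aevalUnit (F := F) u).toRingHom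

/-- The identity map. -/
def of : V ≃ₗ[F] UnitModule u := LinearEquiv.refl F V

theorem smul_of (p : F[T;T⁻¹]) (x : V) : p • of u x = of u (aevalUnit u p x) := rfl

instance : IsScalarTower F F[T;T⁻¹] (UnitModule u) where
  smul_assoc r p x := by
    obtain ⟨x, rfl⟩ := (of u).surjective x
    rw [smul_of, smul_of, map_smul, LinearMap.smul_apply, map_smul]

theorem T_one_smul_of (x : V) : (T 1 : F[T;T⁻¹]) • of u x = of u ((u : Module.End F V) x) := by
  rw [smul_of, aevalUnit_T, zpow_one]

instance [Module.Finite F V] : Module.Finite F (UnitModule u) :=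
  inferInstanceAs (Module.Finite F V)

theorem isTorsion [Module.Finite F V] : Module.IsTorsion F[T;T⁻¹] (UnitModule u) := by
  intro x
  obtain ⟨x, rfl⟩ := (of u).surjective x
  refine ⟨⟨Polynomial.toLaurent (minpoly F (u : Module.End F V)), mem_nonZeroDivisors_of_ne_zero
    (Polynomial.toLaurent_ne_zero.2 (minpoly.ne_zero (Algebra.IsIntegral.isIntegral _)))⟩, ?_⟩
  change Polynomial.toLaurent (minpoly F (u : Module.End F V)) • of u x = 0
  rw [smul_of, aevalUnit_toLaurent, minpoly.aeval, LinearMap.zero_apply, map_zero]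

end UnitModule

/-- A linear equivalence which commutes with the action of `T` is linear over Laurent
polynomials. -/
noncomputable def LinearEquiv.ofMapTSmul {M N : Type*} [AddCommGroup M] [AddCommGroup N]
    [Module F M] [Module F N] [Module F[T;T⁻¹] M] [Module F[T;T⁻¹] N]
    [IsScalarTower F F[T;T⁻¹] M] [IsScalarTower F F[T;T⁻¹] N] (e : M ≃ₗ[F] N)
    (he : ∀ x, e ((T 1 : F[T;T⁻¹]) • x) = (T 1 : F[T;T⁻¹]) • e x) : M ≃ₗ[F[T;T⁻¹]] N :=
  { e with
    map_smul' := by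
      have h : (e.conjAlgEquiv F).toAlgHom.comp (Algebra.lsmul F F (A := F[T;T⁻¹]) M) =
          Algebra.lsmul F F (A := F[T;T⁻¹]) N := by
        apply algHom_ext_T
        ext y
        obtain ⟨x, rfl⟩ := e.surjective y
        simp [he]
      intro p x
      have := LinearMap.congr_fun (DFunLike.congr_fun h p) (e x)
      simpa [LinearEquiv.conj_apply] using this }

namespace UnitModule

theorem nonempty_equiv_iff_isConj {u v : (Module.End F V)ˣ} :
    Nonempty (UnitModule u ≃ₗ[F[T;T⁻¹]] UnitModule v) ↔ IsConj u v := by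
  rw [isConj_iff]
  constructor
  · rintro ⟨e⟩
    let h : V ≃ₗ[F] V := (of u).trans ((e.restrictScalars F).trans (of v).symm)
    refine ⟨(LinearMap.GeneralLinearGroup.generalLinearEquiv F V).symm h, ?_⟩
    rw [mul_inv_eq_iff_eq_mul]
    ext x
    have h1 := e.map_smul (T 1) (of u x)
    rw [T_one_smul_of] at h1
    obtain ⟨y, hy⟩ := (of v).surjective (e (of u x))
    rw [← hy, T_one_smul_of] at h1
    have h2 : h x = y := by
      change (of v).symm (e (of u x)) = y
      rw [← hy]; rfl
    change h ((u : Module.End F V) x) = (v : Module.End F V) (h x)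
    rw [h2]
    change (of v).symm (e (of u ((u : Module.End F V) x))) = _
    rw [h1]; rfl
  · rintro ⟨k, hk⟩
    refine ⟨LinearEquiv.ofMapTSmul ((of u).symm.trans
      ((LinearMap.GeneralLinearGroup.generalLinearEquiv F V k).trans (of v))) fun x => ?_⟩
    obtain ⟨x, rfl⟩ := (of u).surjective x
    rw [mul_inv_eq_iff_eq_mul] at hk
    have h1 := LinearMap.congr_fun (congrArg Units.val hk) x
    rw [T_one_smul_of]
    change of v ((k : Module.End F V) ((u : Module.End F V) x)) =
      (T 1 : F[T;T⁻¹]) • of v ((k : Module.End F V) x)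
    rw [T_one_smul_of]
    exact congrArg (of v) h1

/-- The scalar automorphisms. -/
noncomputable def scalar : Fˣ →* (Module.End F V)ˣ :=
  Units.map (algebraMap F (Module.End F V)).toMonoidHom

theorem scalar_mul_comm (c : Fˣ) (u : (Module.End F V)ˣ) : scalar c * u = u * scalar c :=
  Units.ext (Algebra.commutes (c : F) (u : Module.End F V))

/-- The map induced by the involution `T ↦ c⁻¹ T⁻¹` on a sum of cyclic modules. -/
noncomputable def twistPi {n : ℕ} (c : Fˣ) (I : Fin n → Ideal F[T;T⁻¹]) :
    (∀ k, F[T;T⁻¹] ⧸ I k) ≃ₗ[F] ∀ k, F[T;T⁻¹] ⧸ (I k).map (twist c) :=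
  LinearEquiv.piCongrRight fun k =>
    (Ideal.quotientEquivAlg (I k) ((I k).map (twist c)) (twist c) rfl).toLinearEquiv

theorem twistPi_mk {n : ℕ} (c : Fˣ) (I : Fin n → Ideal F[T;T⁻¹]) (p : Fin n → F[T;T⁻¹]) :
    twistPi c I (fun k => Ideal.Quotient.mk (I k) (p k)) =
      fun k => Ideal.Quotient.mk _ (twist c (p k)) := rfl

theorem exists_mk_eq {n : ℕ} {I : Fin n → Ideal F[T;T⁻¹]} (y : ∀ k, F[T;T⁻¹] ⧸ I k) :
    ∃ p : Fin n → F[T;T⁻¹], y = fun k => Ideal.Quotient.mk (I k) (p k) :=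
  ⟨fun k => (Ideal.Quotient.mk_surjective (y k)).choose,
    funext fun k => (Ideal.Quotient.mk_surjective (y k)).choose_spec.symm⟩

theorem twistPi_smul {n : ℕ} (c : Fˣ) (I : Fin n → Ideal F[T;T⁻¹]) (q : F[T;T⁻¹])
    (y : ∀ k, F[T;T⁻¹] ⧸ I k) : twistPi c I (q • y) = twist c q • twistPi c I y := by
  obtain ⟨p, rfl⟩ := exists_mk_eq y
  have h : (q • fun k => Ideal.Quotient.mk (I k) (p k)) =
      fun k => Ideal.Quotient.mk (I k) (q * p k) := rfl
  rw [h, twistPi_mk, twistPi_mk]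
  funext k
  rw [map_mul]
  rfl

theorem of_scalar_inv_mul_inv (c : Fˣ) (u : (Module.End F V)ˣ) (x : V) :
    of u ((((scalar c)⁻¹ * u⁻¹ : (Module.End F V)ˣ) : Module.End F V) x) =
      twist c (T 1) • of u x := by
  rw [twist_T_one, smul_of, map_mul, C_eq_algebraMap, AlgHom.commutes, aevalUnit_T, zpow_neg_one,
    ← map_inv, ← Units.val_inv_eq_inv_val]
  rfl

/-- The annihilator chain of the automorphism `c⁻¹ u⁻¹`. -/
theorem nonempty_twist_equiv {n : ℕ} {u : (Module.End F V)ˣ} {I : Fin n → Ideal F[T;T⁻¹]}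
    (e : UnitModule u ≃ₗ[F[T;T⁻¹]] ∀ k, F[T;T⁻¹] ⧸ I k) (c : Fˣ) :
    Nonempty (UnitModule ((scalar c)⁻¹ * u⁻¹) ≃ₗ[F[T;T⁻¹]]
      ∀ k, F[T;T⁻¹] ⧸ (I k).map (twist c)) := by
  refine ⟨LinearEquiv.ofMapTSmul ((of _).symm.trans ((of u).trans
    ((e.restrictScalars F).trans (twistPi c I)))) fun x => ?_⟩
  obtain ⟨x, rfl⟩ := (of ((scalar c)⁻¹ * u⁻¹)).surjective x
  rw [T_one_smul_of]
  change twistPi c I (e (of u ((((scalar c)⁻¹ * u⁻¹ : (Module.End F V)ˣ) : Module.End F V) x))) =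
    (T 1 : F[T;T⁻¹]) • twistPi c I (e (of u x))
  rw [of_scalar_inv_mul_inv, map_smul, twistPi_smul, twist_twist]

/-- An automorphism whose annihilator chain is stable under `T ↦ c⁻¹ T⁻¹` is conjugate to
`c⁻¹ u⁻¹` by an involution. -/
theorem exists_involution {n : ℕ} {u : (Module.End F V)ˣ} {I : Fin n → Ideal F[T;T⁻¹]}
    (e : UnitModule u ≃ₗ[F[T;T⁻¹]] ∀ k, F[T;T⁻¹] ⧸ I k) (c : Fˣ)
    (hI : ∀ k, (I k).map (twist c) = I k) :
    ∃ h : (Module.End F V)ˣ, h ^ 2 = 1 ∧ h * u * h⁻¹ = (scalar c)⁻¹ * u⁻¹ := by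
  let t : (∀ k, F[T;T⁻¹] ⧸ I k) ≃ₗ[F] ∀ k, F[T;T⁻¹] ⧸ I k :=
    LinearEquiv.piCongrRight fun k =>
      (Ideal.quotientEquivAlg (I k) (I k) (twist c) (hI k).symm).toLinearEquiv
  have tmk : ∀ p : Fin n → F[T;T⁻¹], t (fun k => Ideal.Quotient.mk (I k) (p k)) =
      fun k => Ideal.Quotient.mk (I k) (twist c (p k)) := fun _ => rfl
  have tt : ∀ y, t (t y) = y := fun y => by
    obtain ⟨p, rfl⟩ := exists_mk_eq y
    rw [tmk, tmk]
    simp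
  have tsmul : ∀ (q : F[T;T⁻¹]) y, t (q • y) = twist c q • t y := fun q y => by
    obtain ⟨p, rfl⟩ := exists_mk_eq y
    have h : (q • fun k => Ideal.Quotient.mk (I k) (p k)) =
        fun k => Ideal.Quotient.mk (I k) (q * p k) := rfl
    rw [h, tmk, tmk]
    funext k
    rw [map_mul]
    rfl
  let E : V ≃ₗ[F] ∀ k, F[T;T⁻¹] ⧸ I k := (of u).trans (e.restrictScalars F)
  have hE : ∀ x, E x = e (of u x) := fun _ => rfl
  let h : V ≃ₗ[F] V := E.trans (t.trans E.symm)
  have hEh : ∀ x, E (h x) = t (E x) := fun x => E.apply_symm_apply _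
  have hh : ∀ x, h (h x) = x := fun x => E.injective (by rw [hEh, hEh, tt])
  refine ⟨(LinearMap.GeneralLinearGroup.generalLinearEquiv F V).symm h, ?_, ?_⟩
  · rw [pow_two]
    ext x
    exact hh x
  · rw [mul_inv_eq_iff_eq_mul]
    ext x
    apply E.injective
    change E (h ((u : Module.End F V) x)) =
      e (of u ((((scalar c)⁻¹ * u⁻¹ : (Module.End F V)ˣ) : Module.End F V) (h x)))
    rw [hEh, of_scalar_inv_mul_inv,
      map_smul, ← hE, hEh, hE, ← T_one_smul_of, map_smul, tsmul]
    rfl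

end UnitModule

end UnitModule

namespace UnitModule

variable {F : Type*} [Field F] {n : ℕ}

/-- Chains of nonzero ideals of Laurent polynomials of total codimension `n`. -/
def IsChainOfCodim (n : ℕ) (I : Fin n → Ideal F[T;T⁻¹]) : Prop :=
  Monotone I ∧ (∀ k, I k ≠ ⊥) ∧ ∑ k, Module.finrank F (F[T;T⁻¹] ⧸ I k) = n

theorem finrank_pi_quotient {I : Fin n → Ideal F[T;T⁻¹]} (hI : ∀ k, I k ≠ ⊥) :
    Module.finrank F (∀ k, F[T;T⁻¹] ⧸ I k) = ∑ k, Module.finrank F (F[T;T⁻¹] ⧸ I k) := by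
  have := fun k => finite_quotient (hI k)
  exact Module.finrank_pi_fintype F

theorem exists_chain (u : (Module.End F (Fin n → F))ˣ) : ∃ I : Fin n → Ideal F[T;T⁻¹],
    IsChainOfCodim n I ∧ Nonempty (UnitModule u ≃ₗ[F[T;T⁻¹]] ∀ k, F[T;T⁻¹] ⧸ I k) := by
  let φ : (Fin n → F[T;T⁻¹]) →ₗ[F[T;T⁻¹]] UnitModule u :=
    Fintype.linearCombination F[T;T⁻¹] fun i => of u (Pi.single i 1)
  have hφ : Function.Surjective φ := by
    intro y
    obtain ⟨x, rfl⟩ := (of u).surjective y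
    refine ⟨fun i => algebraMap F F[T;T⁻¹] (x i), ?_⟩
    rw [Fintype.linearCombination_apply]
    simp only [algebraMap_smul, ← map_smul, ← map_sum]
    congr 1
    rw [← pi_eq_sum_univ' x]
  let q := φ.quotKerEquivOfSurjective hφ
  have hrank : Module.finrank F[T;T⁻¹] (LinearMap.ker φ) =
      Module.finrank F[T;T⁻¹] (Fin n → F[T;T⁻¹]) := by
    have h1 := (LinearMap.ker φ).finrank_quotient_add_finrank
    rw [q.finrank_eq, (isTorsion u).finrank_eq_zero, zero_add] at h1
    exact h1
  let b := Pi.basisFun F[T;T⁻¹] (Fin n)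
  let s := (LinearMap.ker φ).quotientEquivPiSpan b hrank
  set J : Fin n → Ideal F[T;T⁻¹] := fun i =>
    Ideal.span {Submodule.smithNormalFormCoeffs b hrank i} with hJdef
  have hJ : ∏ i, J i ≠ ⊥ := by
    rw [Ne, ← Ideal.zero_eq_bot, Finset.prod_eq_zero_iff]
    rintro ⟨i, -, hi⟩
    rw [hJdef, Ideal.zero_eq_bot, Ideal.span_singleton_eq_bot] at hi
    exact Submodule.smithNormalFormCoeffs_ne_zero b hrank i hi
  obtain ⟨I, hm, hlow, ⟨t⟩⟩ := Ideal.exists_monotone_pi_equiv n J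
  have hI : ∀ k, I k ≠ ⊥ := fun k h => hJ (le_bot_iff.1 (h ▸ hlow (∏ i, J i)
    (fun i => Ideal.prod_le_inf.trans (Finset.inf_le (Finset.mem_univ i))) k))
  let e : UnitModule u ≃ₗ[F[T;T⁻¹]] ∀ k, F[T;T⁻¹] ⧸ I k := (q.symm.trans s).trans t
  refine ⟨I, ⟨hm, hI, ?_⟩, ⟨e⟩⟩
  rw [← finrank_pi_quotient hI, ← (e.restrictScalars F).finrank_eq, ← (of u).finrank_eq]
  simp

theorem exists_unit_of_chain {I : Fin n → Ideal F[T;T⁻¹]} (hI : IsChainOfCodim n I) :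
    ∃ u : (Module.End F (Fin n → F))ˣ,
      Nonempty (UnitModule u ≃ₗ[F[T;T⁻¹]] ∀ k, F[T;T⁻¹] ⧸ I k) := by
  have := fun k => finite_quotient (hI.2.1 k)
  have hr : Module.finrank F (∀ k, F[T;T⁻¹] ⧸ I k) = Module.finrank F (Fin n → F) := by
    rw [finrank_pi_quotient hI.2.1, hI.2.2]
    simp
  let e := LinearEquiv.ofFinrankEq _ _ hr
  let ψ : F[T;T⁻¹] →ₐ[F] Module.End F (Fin n → F) :=
    (e.conjAlgEquiv F).toAlgHom.comp (Algebra.lsmul F F (A := F[T;T⁻¹]) (∀ k, F[T;T⁻¹] ⧸ I k))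
  let u : (Module.End F (Fin n → F))ˣ :=
    Units.map ψ.toRingHom.toMonoidHom (unitOfInvertible (T 1 : F[T;T⁻¹]))
  refine ⟨u, ⟨(LinearEquiv.ofMapTSmul (e.trans (of u)) fun x => ?_).symm⟩⟩
  change of u (e _) = (T 1 : F[T;T⁻¹]) • of u (e x)
  rw [T_one_smul_of]
  congr 1
  change _ = e ((T 1 : F[T;T⁻¹]) • e.symm (e x))
  rw [e.symm_apply_apply]

/-- The annihilator chain of an automorphism. -/
noncomputable def chain (u : (Module.End F (Fin n → F))ˣ) : Fin n → Ideal F[T;T⁻¹] :=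
  (exists_chain u).choose

theorem isChainOfCodim_chain (u : (Module.End F (Fin n → F))ˣ) : IsChainOfCodim n (chain u) :=
  (exists_chain u).choose_spec.1

/-- The decomposition of the module of an automorphism into cyclic modules. -/
noncomputable def chainEquiv (u : (Module.End F (Fin n → F))ˣ) :
    UnitModule u ≃ₗ[F[T;T⁻¹]] ∀ k, F[T;T⁻¹] ⧸ chain u k :=
  (exists_chain u).choose_spec.2.some

theorem chain_eq {u : (Module.End F (Fin n → F))ˣ} {I : Fin n → Ideal F[T;T⁻¹]}
    (hI : Monotone I) (e : UnitModule u ≃ₗ[F[T;T⁻¹]] ∀ k, F[T;T⁻¹] ⧸ I k) : chain u = I :=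
  Ideal.eq_of_monotone_of_pi_equiv (isChainOfCodim_chain u).1 hI ((chainEquiv u).symm.trans e)

theorem chain_eq_chain_iff {u v : (Module.End F (Fin n → F))ˣ} :
    chain u = chain v ↔ IsConj u v := by
  rw [← nonempty_equiv_iff_isConj]
  constructor
  · intro h
    have e := chainEquiv u
    rw [h] at e
    exact ⟨e.trans (chainEquiv v).symm⟩
  · rintro ⟨e⟩
    exact chain_eq (isChainOfCodim_chain v).1 (e.trans (chainEquiv v))

theorem chain_scalar_inv_mul_inv (c : Fˣ) (u : (Module.End F (Fin n → F))ˣ) :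
    chain ((scalar c)⁻¹ * u⁻¹) = fun k => (chain u k).map (twist c) := by
  obtain ⟨e⟩ := nonempty_twist_equiv (chainEquiv u) c
  exact chain_eq (fun i j h => Ideal.map_mono ((isChainOfCodim_chain u).1 h)) e

theorem isConj_scalar_mul_inv_iff {c : Fˣ} {u : (Module.End F (Fin n → F))ˣ} :
    IsConj (scalar c * u) u⁻¹ ↔ ∀ k, (chain u k).map (twist c) = chain u k := by
  have h : IsConj (scalar c * u) u⁻¹ ↔ IsConj ((scalar c)⁻¹ * u⁻¹) u := by
    rw [isConj_comm, isConj_iff, isConj_iff]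
    refine exists_congr fun k => ?_
    have hk : k * ((scalar c)⁻¹ * u⁻¹) * k⁻¹ = (scalar c)⁻¹ * (k * u⁻¹ * k⁻¹) := by
      rw [← mul_assoc k, ← map_inv, ← scalar_mul_comm]
      simp only [mul_assoc]
    rw [hk, inv_mul_eq_iff_eq_mul]
  rw [h, ← chain_eq_chain_iff, chain_scalar_inv_mul_inv, funext_iff]

theorem exists_involution_of_isConj {c : Fˣ} {u : (Module.End F (Fin n → F))ˣ}
    (h : IsConj (scalar c * u) u⁻¹) :
    ∃ k : (Module.End F (Fin n → F))ˣ, k ^ 2 = 1 ∧ k * u * k⁻¹ = (scalar c)⁻¹ * u⁻¹ :=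
  exists_involution (chainEquiv u) c (isConj_scalar_mul_inv_iff.1 h)

/-- Conjugacy classes `x` with `c x = x⁻¹` correspond to the chains stable under
`T ↦ c⁻¹ T⁻¹`. -/
theorem card_smul_eq_invClass (n : ℕ) (c : Fˣ) :
    Nat.card {x : ConjClasses (Module.End F (Fin n → F))ˣ //
      (ConjClasses.centralAction scalar scalar_mul_comm).toSMul.smul c x =
        ConjClasses.invClass x} =
    Nat.card {I : Fin n → Ideal F[T;T⁻¹] //
      IsChainOfCodim n I ∧ ∀ k, (I k).map (twist c) = I k} := by
  let f : ConjClasses (Module.End F (Fin n → F))ˣ → (Fin n → Ideal F[T;T⁻¹]) :=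
    Quotient.lift chain fun u v h => chain_eq_chain_iff.2 h
  have hf : ∀ u, f (ConjClasses.mk u) = chain u := fun _ => rfl
  refine Nat.card_congr (Equiv.ofBijective (fun x => ⟨f x.1, ?_⟩) ⟨?_, ?_⟩)
  · obtain ⟨x, hx⟩ := x
    obtain ⟨u, rfl⟩ := ConjClasses.mk_surjective x
    rw [hf]
    exact ⟨isChainOfCodim_chain u,
      isConj_scalar_mul_inv_iff.1 (ConjClasses.mk_eq_mk_iff_isConj.1 hx)⟩
  · rintro ⟨x, hx⟩ ⟨y, hy⟩ h
    obtain ⟨u, rfl⟩ := ConjClasses.mk_surjective x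
    obtain ⟨v, rfl⟩ := ConjClasses.mk_surjective y
    exact Subtype.ext (ConjClasses.mk_eq_mk_iff_isConj.2
      (chain_eq_chain_iff.1 (congrArg Subtype.val h)))
  · rintro ⟨I, hI, hs⟩
    obtain ⟨u, ⟨e⟩⟩ := exists_unit_of_chain hI
    have hu := chain_eq hI.1 e
    exact ⟨⟨ConjClasses.mk u, ConjClasses.mk_eq_mk_iff_isConj.2
      (isConj_scalar_mul_inv_iff.2 (by rw [hu]; exact hs))⟩, Subtype.ext hu⟩

end UnitModule

section TailProduct

variable {R : Type*} [CommRing R] {n : ℕ}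

/-- The products of the ideals with index at least `k`. -/
noncomputable def tailProd (J : Fin n → Ideal R) (k : Fin n) : Ideal R :=
  ∏ i ∈ Finset.Ici k, J i

theorem tailProd_eq_mul (J : Fin n → Ideal R) (k : Fin n) :
    tailProd J k = J k * ∏ i ∈ Finset.Ioi k, J i :=
  (Finset.mul_prod_Ioi_eq_prod_Ici k).symm

theorem tailProd_ne_bot [IsDomain R] {J : Fin n → Ideal R} (hJ : ∀ k, J k ≠ ⊥) (k : Fin n) :
    tailProd J k ≠ ⊥ :=
  Finset.prod_ne_zero_iff.2 fun i _ => hJ i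

theorem monotone_tailProd (J : Fin n → Ideal R) : Monotone (tailProd J) := fun _ _ h =>
  Ideal.le_of_dvd (Finset.prod_dvd_prod_of_subset _ _ _ (Finset.Ici_subset_Ici.2 h))

theorem tailProd_injective [IsDomain R] [IsPrincipalIdealRing R] {J J' : Fin n → Ideal R}
    (hJ : ∀ k, J k ≠ ⊥)
    (h : tailProd J = tailProd J') : J = J' := by
  funext k
  induction k using WellFoundedGT.induction with
  | ind k ih =>
    have h1 := congrFun h k
    have h2 : ∏ i ∈ Finset.Ioi k, J' i = ∏ i ∈ Finset.Ioi k, J i :=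
      Finset.prod_congr rfl fun i hi => (ih i (Finset.mem_Ioi.1 hi)).symm
    rw [tailProd_eq_mul, tailProd_eq_mul, h2] at h1
    exact mul_right_cancel₀ (Finset.prod_ne_zero_iff.2 fun i _ => hJ i) h1

theorem exists_tailProd_eq [IsDomain R] [IsPrincipalIdealRing R] {I : Fin n → Ideal R}
    (hI : Monotone I) :
    ∃ J, tailProd J = I := by
  have h : ∀ k, ∃ J, I k = J * (if h : (k : ℕ) + 1 < n then I ⟨k + 1, h⟩ else ⊤) := by
    intro k
    split_ifs with h
    · obtain ⟨J, hJ⟩ := Ideal.dvd_iff_le.2 (hI (show k ≤ ⟨k + 1, h⟩ from Nat.le_succ k))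
      exact ⟨J, by rw [hJ, mul_comm]⟩
    · exact ⟨I k, (Ideal.mul_top _).symm⟩
  choose J hJ using h
  refine ⟨J, ?_⟩
  funext k
  induction k using WellFoundedGT.induction with
  | ind k ih =>
    rw [tailProd_eq_mul, hJ k]
    congr 1
    split_ifs with h
    · rw [← ih ⟨k + 1, h⟩ (Nat.lt_succ_self k), tailProd]
      refine Finset.prod_congr (Finset.ext fun i => ?_) fun _ _ => rfl
      rw [Finset.mem_Ioi, Finset.mem_Ici, Fin.lt_def, Fin.le_def]
      exact Nat.lt_iff_add_one_le
    · rw [← Ideal.one_eq_top]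
      refine Finset.prod_eq_one fun i hi => absurd (Finset.mem_Ioi.1 hi) ?_
      have := i.2
      rw [Fin.lt_def]
      omega

end TailProduct

namespace LaurentPolynomial

variable {F : Type*} [Field F] {n : ℕ}

theorem finrank_quotient_prod {ι : Type*} (s : Finset ι) {J : ι → Ideal F[T;T⁻¹]}
    (hJ : ∀ i, J i ≠ ⊥) : Module.finrank F (F[T;T⁻¹] ⧸ ∏ i ∈ s, J i) =
      ∑ i ∈ s, Module.finrank F (F[T;T⁻¹] ⧸ J i) := by
  classical
  induction s using Finset.induction_on with
  | empty =>
    rw [Finset.prod_empty, Finset.sum_empty, Ideal.one_eq_top]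
    exact (finrank_quotient_eq_zero_iff top_ne_bot).2 rfl
  | insert i s hi ih =>
    rw [Finset.prod_insert hi, Finset.sum_insert hi, finrank_quotient_mul (hJ i)
      (Finset.prod_ne_zero_iff.2 fun i _ => hJ i), ih]

theorem sum_finrank_tailProd {J : Fin n → Ideal F[T;T⁻¹]} (hJ : ∀ k, J k ≠ ⊥) :
    ∑ k, Module.finrank F (F[T;T⁻¹] ⧸ tailProd J k) =
      ∑ k : Fin n, Module.finrank F (F[T;T⁻¹] ⧸ J k) * (k + 1) := by
  have h : ∀ k, Module.finrank F (F[T;T⁻¹] ⧸ tailProd J k) =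
      ∑ i ∈ Finset.Ici k, Module.finrank F (F[T;T⁻¹] ⧸ J i) :=
    fun k => finrank_quotient_prod _ hJ
  simp only [h]
  rw [Finset.sum_comm' (t' := Finset.univ) (s' := fun i => Finset.Iic i) (by simp)]
  simp [mul_comm]

/-- Families of nonzero ideals stable under `T ↦ c⁻¹ T⁻¹` of weighted codimension `n`. -/
def IsStableFamily (c : Fˣ) (n : ℕ) (J : Fin n → Ideal F[T;T⁻¹]) : Prop :=
  (∀ k, J k ≠ ⊥ ∧ (J k).map (twist c) = J k) ∧
    ∑ k : Fin n, Module.finrank F (F[T;T⁻¹] ⧸ J k) * (k + 1) = n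

theorem card_stable_chain_eq (c : Fˣ) (n : ℕ) :
    Nat.card {I : Fin n → Ideal F[T;T⁻¹] //
      UnitModule.IsChainOfCodim n I ∧ ∀ k, (I k).map (twist c) = I k} =
    Nat.card {J : Fin n → Ideal F[T;T⁻¹] // IsStableFamily c n J} := by
  have hmap : ∀ J : Fin n → Ideal F[T;T⁻¹],
      tailProd (fun k => (J k).map (twist c)) = fun k => (tailProd J k).map (twist c) := by
    intro J
    funext k
    exact (map_prod (Ideal.mapHom (twist c)) J (Finset.Ici k)).symm
  symm
  refine Nat.card_congr (Equiv.ofBijective (fun J => ⟨tailProd J.1, ⟨monotone_tailProd _,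
    tailProd_ne_bot fun k => (J.2.1 k).1, ?_⟩, ?_⟩) ⟨?_, ?_⟩)
  · rw [sum_finrank_tailProd fun k => (J.2.1 k).1, J.2.2]
  · intro k
    rw [← congrFun (hmap J.1) k]
    congr 1
    funext k
    exact (J.2.1 k).2
  · intro J J' h
    exact Subtype.ext (tailProd_injective (fun k => (J.2.1 k).1) (congrArg Subtype.val h))
  · rintro ⟨I, ⟨hm, h0, hn⟩, hs⟩
    obtain ⟨J, rfl⟩ := exists_tailProd_eq hm
    have hJ : ∀ k, J k ≠ ⊥ := fun k hk => h0 k (by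
      rw [tailProd_eq_mul, hk, ← Ideal.zero_eq_bot, zero_mul])
    have hJs : J = fun k => (J k).map (twist c) :=
      tailProd_injective hJ (by rw [hmap]; exact (funext hs).symm)
    refine ⟨⟨J, fun k => ⟨hJ k, (congrFun hJs k).symm⟩, ?_⟩, rfl⟩
    rw [← sum_finrank_tailProd hJ, hn]

end LaurentPolynomial

@[to_additive]
theorem Fin.prod_univ_eq_prod_Icc {M : Type*} [CommMonoid M] (g : ℕ → M) (n : ℕ) :
    ∏ k : Fin n, g ((k : ℕ) + 1) = ∏ i ∈ Finset.Icc 1 n, g i := by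
  rw [Fin.prod_univ_eq_prod_range (fun k => g (k + 1)) n, Finset.range_eq_Ico,
    Finset.prod_Ico_add' g 0 n 1]
  refine Finset.prod_congr (Finset.ext fun i => ?_) fun _ _ => rfl
  rw [Finset.mem_Ico, Finset.mem_Icc]
  omega

namespace Nat.Partition

variable {n : ℕ}

/-- The partition with `d k` parts equal to `k + 1`. -/
def ofMultiplicities (d : Fin n → ℕ) (hd : ∑ k : Fin n, d k * (k + 1) = n) : n.Partition where
  parts := ∑ k : Fin n, Multiset.replicate (d k) ((k : ℕ) + 1)
  parts_pos := by
    intro i hi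
    obtain ⟨k, -, hk⟩ := Multiset.mem_sum.1 hi
    rw [Multiset.eq_of_mem_replicate hk]
    omega
  parts_sum := by
    have h := map_sum Multiset.sumAddMonoidHom
      (fun k : Fin n => Multiset.replicate (d k) ((k : ℕ) + 1)) Finset.univ
    simp only [Multiset.coe_sumAddMonoidHom, Multiset.sum_replicate, smul_eq_mul] at h
    rw [h, hd]

theorem count_ofMultiplicities (d : Fin n → ℕ) (hd : ∑ k : Fin n, d k * (k + 1) = n) (k : Fin n) :
    (ofMultiplicities d hd).parts.count ((k : ℕ) + 1) = d k := by
  change Multiset.count _ (∑ k : Fin n, Multiset.replicate (d k) ((k : ℕ) + 1)) = _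
  rw [Multiset.count_sum', Finset.sum_eq_single k]
  · rw [Multiset.count_replicate_self]
  · intro j _ hj
    rw [Multiset.count_replicate, if_neg]
    intro h
    exact hj (Fin.ext (by omega))
  · simp

theorem count_eq_zero_of_lt {ν : n.Partition} {m : ℕ} (h : n < m) : ν.parts.count m = 0 :=
  Multiset.count_eq_zero.2 fun hm => absurd (ν.parts_sum ▸ Multiset.le_sum_of_mem hm) (by omega)

theorem ext_count {μ ν : n.Partition}
    (h : ∀ k : Fin n, μ.parts.count ((k : ℕ) + 1) = ν.parts.count ((k : ℕ) + 1)) : μ = ν := by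
  apply Nat.Partition.ext
  ext m
  rcases m with _ | m
  · rw [Multiset.count_eq_zero.2 fun h0 => absurd (μ.parts_pos h0) (lt_irrefl 0),
      Multiset.count_eq_zero.2 fun h0 => absurd (ν.parts_pos h0) (lt_irrefl 0)]
  · by_cases hm : m < n
    · exact h ⟨m, hm⟩
    · rw [count_eq_zero_of_lt (by omega), count_eq_zero_of_lt (by omega)]

theorem sum_count_mul (ν : n.Partition) :
    ∑ k : Fin n, ν.parts.count ((k : ℕ) + 1) * (k + 1) = n := by
  have h := (Finset.mem_finsuppAntidiag.1 ν.toFinsuppAntidiag_mem_finsuppAntidiag).1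
  have h' : ∑ i ∈ Finset.Icc 1 n, ν.parts.count i * i = n := h
  exact (Fin.sum_univ_eq_sum_Icc (fun i => ν.parts.count i * i) n).trans h'

end Nat.Partition

namespace LaurentPolynomial

variable {F : Type*} [Field F] {n : ℕ}

theorem card_isStableFamily [Finite F] (c : Fˣ) (n : ℕ) :
    Nat.card {J : Fin n → Ideal F[T;T⁻¹] // IsStableFamily c n J} =
      ∑ ν : n.Partition, ∏ k : Fin n, numStable c (ν.parts.count ((k : ℕ) + 1)) := by
  let f : {J : Fin n → Ideal F[T;T⁻¹] // IsStableFamily c n J} → n.Partition := fun J =>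
    Nat.Partition.ofMultiplicities (fun k => Module.finrank F (F[T;T⁻¹] ⧸ J.1 k)) J.2.2
  have hf : ∀ J ν, f J = ν ↔ ∀ k : Fin n,
      Module.finrank F (F[T;T⁻¹] ⧸ J.1 k) = ν.parts.count ((k : ℕ) + 1) := by
    intro J ν
    constructor
    · rintro rfl k
      exact (Nat.Partition.count_ofMultiplicities _ J.2.2 k).symm
    · intro h
      refine Nat.Partition.ext_count fun k => ?_
      rw [← h k]
      exact Nat.Partition.count_ofMultiplicities _ J.2.2 k
  let S (ν : n.Partition) (k : Fin n) := {I : Ideal F[T;T⁻¹] // I ≠ ⊥ ∧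
    Module.finrank F (F[T;T⁻¹] ⧸ I) = ν.parts.count ((k : ℕ) + 1) ∧ I.map (twist c) = I}
  have hfin : ∀ ν k, Finite (S ν k) := fun ν k => by
    have := finite_stable (F := F) (ν.parts.count ((k : ℕ) + 1))
    exact Finite.of_injective (β := {I : Ideal F[T;T⁻¹] // I ≠ ⊥ ∧
      Module.finrank F (F[T;T⁻¹] ⧸ I) = ν.parts.count ((k : ℕ) + 1)})
      (fun I => ⟨I.1, I.2.1, I.2.2.1⟩)
      (fun I J h => by
        have h' := Subtype.ext_iff.1 h
        exact Subtype.ext h')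
  let e (ν : n.Partition) : {J // f J = ν} ≃ ∀ k, S ν k :=
    { toFun := fun J k => ⟨J.1.1 k, (J.1.2.1 k).1, (hf _ _).1 J.2 k, (J.1.2.1 k).2⟩
      invFun := fun g => ⟨⟨fun k => (g k).1, fun k => ⟨(g k).2.1, (g k).2.2.2⟩, by
          simp only [fun k => (g k).2.2.1]
          exact ν.sum_count_mul⟩, (hf _ _).2 fun k => (g k).2.2.1⟩
      left_inv := fun _ => rfl
      right_inv := fun _ => rfl }
  rw [← Nat.card_congr (Equiv.sigmaFiberEquiv f), Nat.card_congr (Equiv.sigmaCongrRight e),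
    Nat.card_sigma]
  refine Finset.sum_congr rfl fun ν _ => ?_
  rw [Nat.card_pi]
  rfl

end LaurentPolynomial

theorem one_lt_twoPart_iff {k : ℕ} (hk : k ≠ 0) : 1 < twoPart k ↔ Even k := by
  have : Fact (Nat.Prime 2) := ⟨Nat.prime_two⟩
  rw [twoPart, even_iff_two_dvd, dvd_iff_padicValNat_ne_zero hk]
  exact Nat.one_lt_two_pow_iff

theorem even_twoPart_iff {k : ℕ} (hk : k ≠ 0) : Even (twoPart k) ↔ Even k := by
  rw [← one_lt_twoPart_iff hk, twoPart]
  by_cases h : padicValNat 2 k = 0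
  · simp [h]
  · simp [h, Nat.even_pow]

theorem one_lt_twoPart_partitionD_mul_iff {n : ℕ} (hn : 1 ≤ n) {q : ℕ} (hq : q ≠ 0)
    (ν : n.Partition) :
    1 < twoPart (partitionD ν * q) ↔
      Even q ∨ ∀ k : Fin n, Even (ν.parts.count ((k : ℕ) + 1)) := by
  set g := (Finset.Icc 1 n).gcd fun i => ν.parts.count i with hg
  have hg0 : g ≠ 0 := by
    intro h
    rw [hg, Finset.gcd_eq_zero_iff] at h
    have hs := ν.sum_count_mul
    rw [Fin.sum_univ_eq_sum_Icc (fun i => ν.parts.count i * i) n, Finset.sum_eq_zero] at hs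
    · omega
    · intro i hi
      rw [h i hi, zero_mul]
  have hd0 : partitionD ν ≠ 0 := pow_ne_zero _ two_ne_zero
  have hd : Even (partitionD ν) ↔ Even g := even_twoPart_iff hg0
  rw [one_lt_twoPart_iff (mul_ne_zero hd0 hq), Nat.even_mul, hd, or_comm, even_iff_two_dvd (a := g), hg,
    Finset.dvd_gcd_iff]
  refine or_congr_right ⟨fun h k => even_iff_two_dvd.2 (h _ ?_), fun h i hi => ?_⟩
  · have := k.2
    rw [Finset.mem_Icc]
    omega
  · rw [Finset.mem_Icc] at hi
    have := h ⟨i - 1, by omega⟩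
    rw [Nat.sub_add_cancel hi.1] at this
    exact even_iff_two_dvd.1 this

section FiniteField

variable {F : Type*} [Field F] [Finite F]

theorem isSquare_units_of_even_card (hF : Even (Nat.card F)) (c : Fˣ) : IsSquare c := by
  have := Fintype.ofFinite F
  rw [Nat.card_eq_fintype_card] at hF
  obtain ⟨b, hb⟩ := FiniteField.isSquare_of_char_two
    (FiniteField.even_card_iff_char_two.2 (Nat.even_iff.1 hF)) (c : F)
  have hb0 : b ≠ 0 := by
    rintro rfl
    exact c.ne_zero (by rw [hb, mul_zero])
  exact ⟨Units.mk0 b hb0, Units.ext hb⟩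

theorem two_mul_card_isSquare_units (hF : ¬ Even (Nat.card F)) :
    2 * Nat.card {c : Fˣ // IsSquare c} = Nat.card Fˣ := by
  have hchar : ringChar F ≠ 2 := by
    have := Fintype.ofFinite F
    rw [Nat.card_eq_fintype_card] at hF
    intro h
    exact hF (Nat.even_iff.2 (FiniteField.even_card_iff_char_two.1 h))
  have hne : (-1 : F) ≠ 1 := Ring.neg_one_ne_one_of_char_ne_two hchar
  let φ : Fˣ →* Fˣ := powMonoidHom 2
  have h1 := φ.ker.card_mul_index
  rw [Subgroup.index_ker] at h1
  have h2 : Nat.card φ.ker = 2 := by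
    have hk : (φ.ker : Set Fˣ) = {1, -1} := by
      ext c
      change c ^ 2 = 1 ↔ c = 1 ∨ c = -1
      rw [Units.ext_iff, Units.ext_iff, Units.ext_iff]
      simp
    change Nat.card (φ.ker : Set Fˣ) = 2
    rw [hk, Nat.card_coe_set_eq, Set.ncard_pair]
    intro h
    exact hne (by simpa using (congrArg Units.val h).symm)
  have h3 : Nat.card {c : Fˣ // IsSquare c} = Nat.card φ.range := by
    refine Nat.card_congr (Equiv.subtypeEquivRight fun c => ?_)
    rw [MonoidHom.mem_range]
    exact exists_congr fun b => by
      change c = b * b ↔ b ^ 2 = c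
      rw [pow_two, eq_comm]
  rw [h3, ← h1, h2]

theorem sum_prod_numStable {n q : ℕ} (hn : 1 ≤ n) (hq : Nat.card F = q) (ν : n.Partition)
    [Fintype Fˣ] :
    (∑ c : Fˣ, ∏ k : Fin n, numStable c (ν.parts.count ((k : ℕ) + 1)) : ℚ) =
      Nat.card Fˣ * (1 / 2 ^ partitionSigma q ν *
        ∏ k : Fin n, (numStable (1 : Fˣ) (ν.parts.count ((k : ℕ) + 1)) : ℚ)) := by
  classical
  set P : ℚ := ∏ k : Fin n, (numStable (1 : Fˣ) (ν.parts.count ((k : ℕ) + 1)) : ℚ) with hP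
  have hq0 : q ≠ 0 := hq ▸ Nat.card_pos.ne'
  have hsq : ∀ c : Fˣ, IsSquare c →
      (∏ k : Fin n, numStable c (ν.parts.count ((k : ℕ) + 1)) : ℚ) = P := by
    rintro _ ⟨b, rfl⟩
    refine Finset.prod_congr rfl fun k _ => ?_
    rw [← pow_two, numStable_sq]
  rw [partitionSigma]
  split_ifs with h
  · have hall : ∀ c : Fˣ,
        (∏ k : Fin n, numStable c (ν.parts.count ((k : ℕ) + 1)) : ℚ) = P := by
      intro c
      rcases (one_lt_twoPart_partitionD_mul_iff hn hq0 ν).1 h with h | h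
      · exact hsq c (isSquare_units_of_even_card (hq ▸ h) c)
      · exact Finset.prod_congr rfl fun k _ => by rw [numStable_of_even c (h k)]
    simp only [hall]
    rw [Finset.sum_const, Finset.card_univ, nsmul_eq_mul, Nat.card_eq_fintype_card]
    ring
  · rw [one_lt_twoPart_partitionD_mul_iff hn hq0, not_or, not_forall] at h
    obtain ⟨hodd, k, hk⟩ := h
    have hval : ∀ c : Fˣ,
        (∏ k : Fin n, numStable c (ν.parts.count ((k : ℕ) + 1)) : ℚ) =
          if IsSquare c then P else 0 := by
      intro c
      split_ifs with hc
      · exact hsq c hc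
      · refine Finset.prod_eq_zero (Finset.mem_univ k) ?_
        rw [numStable_eq_zero hc (Nat.not_even_iff_odd.1 hk), Nat.cast_zero]
    simp only [hval]
    rw [← Finset.sum_filter, Finset.sum_const, nsmul_eq_mul,
      ← two_mul_card_isSquare_units (F := F) (by rwa [hq]), Nat.card_eq_fintype_card,
      Fintype.card_subtype]
    push_cast
    ring

end FiniteField

section Projective

variable {F : Type*} [Field F] {n : ℕ}

/-- The projection of the linear group onto the projective linear group. -/
noncomputable def toProjective (F : Type*) [Field F] (n : ℕ) :
    (Module.End F (Fin n → F))ˣ →* PGL(n, F) :=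
  Matrix.ProjGenLinGroup.mk.comp
    (Matrix.GeneralLinearGroup.toLin (n := Fin n) (R := F)).symm.toMonoidHom

theorem toProjective_surjective : Function.Surjective (toProjective F n) :=
  Matrix.ProjGenLinGroup.mk_surjective.comp Matrix.GeneralLinearGroup.toLin.symm.surjective

theorem toLin_scalar (c : Fˣ) :
    Matrix.GeneralLinearGroup.toLin (Matrix.GeneralLinearGroup.scalar (Fin n) c) =
      UnitModule.scalar c := by
  ext x
  simp [UnitModule.scalar, Pi.single_apply]

theorem toProjective_eq_iff (u v : (Module.End F (Fin n → F))ˣ) :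
    toProjective F n u = toProjective F n v ↔ ∃ c, UnitModule.scalar c * u = v := by
  change Matrix.ProjGenLinGroup.mk _ = Matrix.ProjGenLinGroup.mk _ ↔ _
  rw [Matrix.ProjGenLinGroup.mk_eq_mk_iff]
  refine exists_congr fun c => ?_
  rw [UnitModule.scalar_mul_comm, ← toLin_scalar]
  constructor
  · intro h
    have := congrArg Matrix.GeneralLinearGroup.toLin h
    rw [map_mul] at this
    simpa using this
  · rintro rfl
    apply Matrix.GeneralLinearGroup.toLin.injective
    rw [map_mul]
    simp

theorem isStronglyRealElement_of_isRealElement {g : PGL(n, F)} (hg : IsRealElement g) :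
    IsStronglyRealElement g := by
  obtain ⟨h, hh⟩ := hg
  obtain ⟨u, rfl⟩ := toProjective_surjective g
  obtain ⟨k, rfl⟩ := toProjective_surjective h
  rw [← map_inv, ← map_mul, ← map_mul, ← map_inv, eq_comm, toProjective_eq_iff] at hh
  obtain ⟨c, hc⟩ := hh
  have hconj : IsConj (UnitModule.scalar c⁻¹ * u) u⁻¹ := by
    rw [isConj_iff]
    refine ⟨k, ?_⟩
    rw [← mul_assoc, ← UnitModule.scalar_mul_comm, mul_assoc, mul_assoc, ← mul_assoc k, ← hc,
      ← mul_assoc, ← map_mul, inv_mul_cancel, map_one, one_mul]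
  obtain ⟨t, ht, htu⟩ := UnitModule.exists_involution_of_isConj hconj
  refine ⟨toProjective F n t, by rw [← map_pow, ht, map_one], ?_⟩
  rw [← map_inv, ← map_mul, ← map_mul, htu, ← map_inv (toProjective F n), eq_comm, toProjective_eq_iff]
  exact ⟨c, by rw [← map_inv, inv_inv]⟩

theorem card_isRealClass_projective_mul_card [Finite F] [Fintype Fˣ] :
    Nat.card {y : ConjClasses PGL(n, F) // IsRealClass y} * Nat.card Fˣ =
      ∑ c : Fˣ, ∑ ν : n.Partition, ∏ k : Fin n, numStable c (ν.parts.count ((k : ℕ) + 1)) := by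
  rw [ConjClasses.card_isRealClass_mul_card UnitModule.scalar UnitModule.scalar_mul_comm
    (toProjective F n) toProjective_surjective toProjective_eq_iff]
  have : Finite (Module.End F (Fin n → F)) := Module.finite_of_finite F
  have : Finite (ConjClasses (Module.End F (Fin n → F))ˣ) := Quotient.finite _
  rw [Nat.card_sigma]
  refine Finset.sum_congr rfl fun c _ => ?_
  rw [UnitModule.card_smul_eq_invClass, card_stable_chain_eq, card_isStableFamily]

end Projective

theorem theoremt (F : Type*) [Field F] [Finite F] (q : ℕ) (hq : Nat.card F = q)
    (n : ℕ) (hn : 1 ≤ n) :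
    (Nat.card {c : ConjClasses PGL(n, F) // IsRealClass c} : ℚ) =
        ∑ ν : n.Partition, (1 / 2 ^ partitionSigma q ν : ℚ) *
          ∏ i ∈ Finset.Icc 1 n with 0 < ν.parts.count i,
            (numSelfReciprocal F (ν.parts.count i) : ℚ) ∧
      ∀ c : ConjClasses PGL(n, F), IsRealClass c → IsStronglyRealClass c := by
  refine ⟨?_, fun c hc g hg => isStronglyRealElement_of_isRealElement (hc g hg)⟩
  have := Fintype.ofFinite Fˣ
  have hprod : ∀ ν : n.Partition, (∏ i ∈ Finset.Icc 1 n with 0 < ν.parts.count i,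
      (numSelfReciprocal F (ν.parts.count i) : ℚ)) =
      ∏ k : Fin n, (numStable (1 : Fˣ) (ν.parts.count ((k : ℕ) + 1)) : ℚ) := by
    intro ν
    rw [Fin.prod_univ_eq_prod_Icc (fun i => (numStable (1 : Fˣ) (ν.parts.count i) : ℚ)) n,
      Finset.prod_filter]
    refine Finset.prod_congr rfl fun i _ => ?_
    split_ifs with h
    · rw [numStable_one]
    · rw [Nat.eq_zero_of_not_pos h, numStable_zero, Nat.cast_one]
  simp only [hprod]
  have hcard := congrArg (Nat.cast (R := ℚ))
    (card_isRealClass_projective_mul_card (F := F) (n := n))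
  push_cast at hcard
  rw [Finset.sum_comm] at hcard
  simp only [sum_prod_numStable hn hq] at hcard
  rw [← Finset.mul_sum, mul_comm] at hcard
  exact mul_left_cancel₀ (Nat.cast_ne_zero.2 Nat.card_pos.ne') hcard
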